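/- All graphs are finite, simple and undirected; a path is a walk without repeated vertices, its length is its number of edges, and $d_G(s,t)$ is the length of a shortest $(s,t)$-path in $G$. For a graph $G$ and $s,t\in V(G)$, the $(s,t)$-relevant part $G_{s,t}$ of $G$ is the subgraph of $G$ induced by all vertices that lie on some $(s,t)$-path of $G$. A tree decomposition of a graph $H$ is a tree $T$ with bags $X_i\subseteq V(H)$, $i\in V(T)$, such that every vertex of $H$ lies in some bag, the two ends of every edge of $H$ lie in a common bag, and for every $v\in V(H)$ the set $\{i\in V(T) : v\in X_i\}$ induces a connected subtree of $T$; its width is $\max_{i} |X_i|-1$, and the treewidth $\operatorname{tw}(H)$ is the smallest width of a tree decomposition of $H$. A function $f:\mathbb{N}\to\mathbb{N}$ is called detour-enforcing if, for all $k\in\mathbb{N}$ (where $0\in\mathbb{N}$) and all graphs $G$ with vertices $s,t\in V(G)$, $\operatorname{tw}(G_{s,t})>f(k)$ implies that $G$ contains an $(s,t)$-path of length at least $d_G(s,t)+k$. **Theorem.** The function $f:\mathbb{N}\to\mathbb{N}$, $f(k)=32k+2$, is detour-enforcing. That is, for every $k\in\mathbb{N}$, every graph $G$ and all $s,t\in V(G)$: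 if $\operatorname{tw}(G_{s,t})>32k+2$, then $G$ contains an $(s,t)$-path of length at least $d_G(s,t)+k$. -/

import Mathlib

universe u

namespace LongestDetour

/-- A tree decomposition of `G` over the tree `T`. -/
structure TreeDecomposition {V : Type u} (G : SimpleGraph V) {ι : Type} (T : SimpleGraph ι) where
  isTree : T.IsTree
  bag : ι → Finset V
  /-- Every vertex is in at least one bag. -/
  vertex_mem : ∀ v : V, ∃ i, v ∈ bag i
  /-- Every edge is contained in some bag. -/
  edge_mem : ∀ u v : V, G.Adj u v → ∃ i, u ∈ bag i ∧ v ∈ bag i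
  /-- The nodes whose bags contain a given vertex induce a connected subtree. -/
  connected : ∀ v : V, (T.induce {i | v ∈ bag i}).Connected

/-- The size of a largest bag, minus one. It is an integer because the graph without vertices has
a decomposition of width `-1`. -/
def TreeDecomposition.width {V : Type u} {G : SimpleGraph V} {ι : Type} [Fintype ι]
    {T : SimpleGraph ι} (D : TreeDecomposition G T) : ℤ :=
  ((Finset.univ.sup fun i => (D.bag i).card : ℕ) : ℤ) - 1

/-- The widths of all tree decompositions of `G` over finite trees. -/
def widths {V : Type u} (G : SimpleGraph V) : Set ℤ :=
  {w | ∃ (m : ℕ) (T : SimpleGraph (Fin m)) (D : TreeDecomposition G T), D.width = w}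

/-- The treewidth of a finite graph: the smallest width of a tree decomposition. -/
noncomputable def treewidth {V : Type u} (G : SimpleGraph V) : ℤ :=
  sInf (widths G)

/-- For a finite graph the infimum in the definition of the treewidth is a minimum. -/
theorem isLeast_treewidth {V : Type u} [Finite V] (G : SimpleGraph V) :
    IsLeast (widths G) (treewidth G) := by
  have hb : BddBelow (widths G) := by
    refine ⟨-1, ?_⟩
    rintro w ⟨m, T, D, rfl⟩
    unfold TreeDecomposition.width
    omega
  have hn : (widths G).Nonempty := by
    classical
    have := Fintype.ofFinite V
    refine ⟨_, 1, ⊥, ⟨SimpleGraph.IsTree.of_subsingleton, fun _ => Finset.univ,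
      fun v => ⟨0, Finset.mem_univ v⟩, fun u v _ => ⟨0, Finset.mem_univ u, Finset.mem_univ v⟩,
      fun v => ?_⟩, rfl⟩
    have : Nonempty {i : Fin 1 | v ∈ (Finset.univ : Finset V)} := ⟨⟨0, Finset.mem_univ v⟩⟩
    exact SimpleGraph.IsTree.of_subsingleton.connected
  exact ⟨Int.csInf_mem hn hb, fun w hw => csInf_le hb hw⟩

/-- The vertices lying on some `(s,t)`-path of `G`. -/
def relevantSet {V : Type u} (G : SimpleGraph V) (s t : V) : Set V :=
  {v | ∃ p : G.Walk s t, p.IsPath ∧ v ∈ p.support}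

/-- The `(s,t)`-relevant part of `G`. -/
def relevantPart {V : Type u} (G : SimpleGraph V) (s t : V) : SimpleGraph (relevantSet G s t) :=
  G.induce (relevantSet G s t)

/-- `f` is detour-enforcing: if the `(s,t)`-relevant part of a finite graph `G` has treewidth
greater than `f k`, then `G` has an `(s,t)`-path of length at least `d_G(s,t) + k`. If `s` and `t`
lie in different components, then the relevant part has no vertices and treewidth `-1`, so the
value of `G.dist s t` plays no role there. -/
def DetourEnforcing (f : ℕ → ℕ) : Prop :=
  ∀ (k : ℕ) (V : Type u) [Finite V] (G : SimpleGraph V) (s t : V),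
    (f k : ℤ) < treewidth (relevantPart G s t) →
      ∃ p : G.Walk s t, p.IsPath ∧ G.dist s t + k ≤ p.length

end LongestDetour

namespace LongestDetour

open SimpleGraph

variable {V : Type u} {G : SimpleGraph V}

/-! Restrict to the relevant part, so that every vertex lies on an `s`-`t` path, and suppose that
all `s`-`t` paths are shorter than `d(s,t) + k` with `k > 0`. The treewidth is then at most `6k +
3`, which is at most `32k + 2`.

The decomposition is built by repeatedly deleting a vertex `σ` from a connected set `C` and passing
to the components of `C - σ`. The bags are `N(C) ∪ {σ}`, with `N(C)` the set of outer neighbours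
(`hasDecomp_of_step`). To keep `|N(C)| ≤ 6k + 3`, every `C` carries a frame: disjoint paths `A` from
`s` to `a` and `B` from `t` to `b` that avoid `C`, cover `N(C)` and end in it.

If `N(C)` is not full, `σ` is a neighbour of `a`. If some `σ` leaves no component attached to both
`a` and `b`, every component loses an outer neighbour in exchange for `σ`. Otherwise no vertex of
`C` separates `a` from `b`, and one path, say `A`, has two outer neighbours at distance at least
`3k` from `a` along `A`. Two disjoint links from such far neighbours to the part of `C` between `a`
and `b` would permit a reroute traversing a long piece of `A` downwards, or returning from that part
to `A`; either contradicts the near-monotonicity of `d(s,·)` along `s`-`t` paths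
(`not_disjoint_links`). By Menger one vertex `x` separates the two sets. Chosen closest to the far
neighbours, `x` has a fan to two of them. Deleting `x` and routing `A` through this fan yields the
next frames (`Frame.framed_of_fan`). -/

/-! ### Links inside a set, and Menger's theorem for two paths -/

/-- `x` and `y` are joined by a walk inside `S`. -/
def Linked (G : SimpleGraph V) (S : Set V) (x y : V) : Prop :=
  ∃ p : G.Walk x y, ∀ z ∈ p.support, z ∈ S

namespace Linked

variable {S T : Set V} {x y z : V}

theorem refl (h : x ∈ S) : Linked G S x x := ⟨.nil, by simpa using h⟩

theorem symm (h : Linked G S x y) : Linked G S y x := by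
  obtain ⟨p, hp⟩ := h
  exact ⟨p.reverse, by simpa using hp⟩

theorem trans (h : Linked G S x y) (h' : Linked G S y z) : Linked G S x z := by
  obtain ⟨p, hp⟩ := h
  obtain ⟨q, hq⟩ := h'
  refine ⟨p.append q, fun w hw => ?_⟩
  rw [Walk.mem_support_append_iff] at hw
  exact hw.elim (hp w) (hq w)

theorem mono (h : Linked G S x y) (hST : S ⊆ T) : Linked G T x y := by
  obtain ⟨p, hp⟩ := h
  exact ⟨p, fun w hw => hST (hp w hw)⟩

theorem left_mem (h : Linked G S x y) : x ∈ S := by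
  obtain ⟨p, hp⟩ := h
  exact hp _ p.start_mem_support

theorem right_mem (h : Linked G S x y) : y ∈ S := h.symm.left_mem

theorem of_adj (h : G.Adj x y) (hx : x ∈ S) (hy : y ∈ S) : Linked G S x y :=
  ⟨h.toWalk, by simp [hx, hy]⟩

theorem of_walk (p : G.Walk x y) : Linked G {v | v ∈ p.support} x y := ⟨p, fun _ h => h⟩

theorem exists_isPath (h : Linked G S x y) :
    ∃ p : G.Walk x y, p.IsPath ∧ ∀ z ∈ p.support, z ∈ S := by
  classical
  obtain ⟨p, hp⟩ := h
  exact ⟨p.bypass, p.bypass_isPath, fun z hz => hp z (p.support_bypass_subset_support hz)⟩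

end Linked

/-- A walk that meets `X` splits at its first vertex in `X`. -/
theorem exists_append_first {u v : V} (p : G.Walk u v) (X : Set V) (h : ∃ x ∈ p.support, x ∈ X) :
    ∃ x ∈ X, ∃ (q : G.Walk u x) (r : G.Walk x v),
      p = q.append r ∧ ∀ y ∈ q.support, y ∈ X → y = x := by
  induction p with
  | nil =>
    obtain ⟨x, hx, hX⟩ := h
    obtain rfl : x = _ := by simpa using hx
    exact ⟨x, hX, .nil, .nil, rfl, by simp⟩
  | @cons a b c hab p ih =>
    by_cases ha : a ∈ X
    · exact ⟨a, ha, .nil, .cons hab p, rfl, by simp⟩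
    · obtain ⟨x, hx, hX⟩ := h
      have hxp : x ∈ p.support := by
        rcases List.mem_cons.1 hx with rfl | hx
        · exact absurd hX ha
        · exact hx
      obtain ⟨y, hy, q, r, rfl, hq⟩ := ih ⟨x, hxp, hX⟩
      refine ⟨y, hy, .cons hab q, r, rfl, fun w hw hwX => ?_⟩
      rcases List.mem_cons.1 hw with rfl | hw
      · exact absurd hwX ha
      · exact hq w hw hwX

theorem Linked.first_hit {S X : Set V} {u v : V} (h : Linked G S u v) (hv : v ∈ X) :
    ∃ x ∈ X, x ∈ S ∧ Linked G (S \ X ∪ {x}) u x := by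
  obtain ⟨p, hp⟩ := h
  obtain ⟨x, hx, q, r, rfl, hq⟩ := exists_append_first p X ⟨v, p.end_mem_support, hv⟩
  refine ⟨x, hx, hp x (by simp), q, fun y hy => ?_⟩
  by_cases hyX : y ∈ X
  · exact Or.inr (hq y hy hyX)
  · exact Or.inl ⟨hp y (by simp [hy]), hyX⟩

/-- A link between `X` and `Y` contains one that meets `X` and `Y` only in its ends. -/
theorem Linked.trim {S X Y : Set V} {x y : V} (h : Linked G S x y) (hx : x ∈ X) (hy : y ∈ Y) :
    ∃ x' ∈ X, ∃ y' ∈ Y, ∃ T ⊆ S, Linked G T x' y' ∧ T ∩ X ⊆ {x'} ∧ T ∩ Y ⊆ {y'} := by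
  obtain ⟨y', hy', hyS, h1⟩ := h.first_hit hy
  obtain ⟨x', hx', hxS, h2⟩ := h1.symm.first_hit hx
  refine ⟨x', hx', y', hy', _, ?_, h2.symm, ?_, ?_⟩
  · rintro z (⟨(hz | rfl), -⟩ | rfl)
    · exact hz.1
    · exact hyS
    · rcases hxS with h | rfl
      · exact h.1
      · exact hyS
  · rintro z ⟨(hz | hz), hzX⟩
    · exact absurd hzX hz.2
    · exact hz
  · rintro z ⟨(⟨hz, -⟩ | rfl), hzY⟩
    · exact hz.elim (fun h => absurd hzY h.2) id
    · exact hxS.elim (fun h => absurd hzY h.2) id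

/-- Induction along a walk to `Y`: one of two disjoint links from `X` ends at the current vertex of
the walk, the other already ends in `Y`. When the walk reaches `Y`, both do. -/
theorem menger_two_aux {S X Y : Set V}
    (h : ∀ v, ∃ x ∈ X, ∃ y ∈ Y, Linked G (S \ {v}) x y) {u y : V} (p : G.Walk u y) (hy : y ∈ Y)
    (hp : ∀ z ∈ p.support, z ∈ S)
    (hPQ : ∃ x₁ ∈ X, ∃ x₂ ∈ X, ∃ y₂ ∈ Y, ∃ S₁ ⊆ S, ∃ S₂ ⊆ S,
      Disjoint S₁ S₂ ∧ Linked G S₁ x₁ u ∧ Linked G S₂ x₂ y₂) :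
    ∃ x₁ ∈ X, ∃ y₁ ∈ Y, ∃ x₂ ∈ X, ∃ y₂ ∈ Y, ∃ S₁ ⊆ S, ∃ S₂ ⊆ S,
      Disjoint S₁ S₂ ∧ Linked G S₁ x₁ y₁ ∧ Linked G S₂ x₂ y₂ := by
  classical
  induction p with
  | nil =>
    obtain ⟨x₁, hx₁, x₂, hx₂, y₂, hy₂, S₁, hS₁, S₂, hS₂, hd, h1, h2⟩ := hPQ
    exact ⟨x₁, hx₁, _, hy, x₂, hx₂, y₂, hy₂, S₁, hS₁, S₂, hS₂, hd, h1, h2⟩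
  | @cons u v y huv p ih =>
    refine ih hy (fun z hz => hp z (by simp [hz])) ?_
    have hvS : v ∈ S := hp v (by simp)
    obtain ⟨x₁, hx₁, x₂, hx₂, y₂, hy₂, S₁, hS₁, S₂, hS₂, hd, h1, h2⟩ := hPQ
    obtain ⟨Q, hQ, hQS⟩ := h2.exists_isPath
    by_cases hvQ : v ∈ Q.support
    swap
    · refine ⟨x₁, hx₁, x₂, hx₂, y₂, hy₂, insert v S₁, ?_, {z | z ∈ Q.support}, ?_, ?_, ?_, .of_walk Q⟩
      · exact Set.insert_subset hvS hS₁
      · exact fun z hz => hS₂ (hQS z hz)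
      · rw [Set.disjoint_left]
        rintro z (rfl | hz) hzQ
        · exact hvQ hzQ
        · exact Set.disjoint_left.1 hd hz (hQS z hzQ)
      · exact (h1.mono (Set.subset_insert _ _)).trans
          (.of_adj huv (Or.inr h1.right_mem) (Or.inl rfl))
    obtain ⟨P, hP⟩ := h1
    have hPQ : ∀ z ∈ P.support, z ∉ Q.support := fun z hz hz' =>
      Set.disjoint_left.1 hd (hP z hz) (hQS z hz')
    set Q₁ := Q.takeUntil v hvQ with hQ₁
    have hQ₁p : Q₁.IsPath := hQ.takeUntil hvQ
    have hQ₁Q : ∀ z ∈ Q₁.support, z ∈ Q.support := fun z hz =>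
      Q.support_takeUntil_subset_support hvQ hz
    -- The walk runs into the other link `Q` at `v`. A link `R` avoiding `v`, followed back from `Y`
    -- to its first vertex on `P` or on the part `Q₁` of `Q` before `v`, supplies a new ending in
    -- `Y`; the untouched one of `P` and `Q₁` serves as the link to `v`.
    obtain ⟨x, hx, y', hy', R, hR⟩ := h v
    by_cases hhit : ∃ w ∈ R.reverse.support, w ∈ {z | z ∈ P.support ∨ z ∈ Q₁.support}
    swap
    · refine ⟨x₂, hx₂, x, hx, y', hy', {z | z ∈ Q₁.support}, ?_, {z | z ∈ R.support}, ?_, ?_,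
        .of_walk _, .of_walk _⟩
      · exact fun z hz => hS₂ (hQS z (hQ₁Q z hz))
      · exact fun z hz => (hR z hz).1
      · rw [Set.disjoint_left]
        exact fun z hz hz' => hhit ⟨z, by simpa using hz', Or.inr hz⟩
    obtain ⟨w, hw, T, T', hTT, hT⟩ := exists_append_first _ _ hhit
    have hTR : ∀ z ∈ T.support, z ∈ R.support := by
      intro z hz
      have : z ∈ R.reverse.support := by rw [hTT]; simp [hz]
      simpa using this
    rcases hw with hw | hw
    · refine ⟨x₂, hx₂, x₁, hx₁, y', hy', {z | z ∈ Q₁.support}, ?_,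
        {z | z ∈ P.support ∨ z ∈ T.support}, ?_, ?_, .of_walk _, ?_⟩
      · exact fun z hz => hS₂ (hQS z (hQ₁Q z hz))
      · rintro z (hz | hz)
        · exact hS₁ (hP z hz)
        · exact (hR z (hTR z hz)).1
      · rw [Set.disjoint_left]
        rintro z hz (hz' | hz')
        · exact hPQ z hz' (hQ₁Q z hz)
        · obtain rfl := hT z hz' (Or.inr hz)
          exact hPQ z hw (hQ₁Q z hz)
      · refine Linked.trans (y := w) ⟨P.takeUntil w hw, fun z hz => Or.inl ?_⟩
          ⟨T.reverse, fun z hz => Or.inr (by simpa using hz)⟩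
        exact P.support_takeUntil_subset_support hw hz
    · have hwv : w ≠ v := fun e => (hR w (hTR w T.end_mem_support)).2 e
      have hvw : v ∉ (Q₁.takeUntil w hw).support :=
        Walk.endpoint_notMem_support_takeUntil hQ₁p hw hwv.symm
      refine ⟨x₁, hx₁, x₂, hx₂, y', hy', {z | z ∈ P.support ∨ z = v}, ?_,
        {z | z ∈ (Q₁.takeUntil w hw).support ∨ z ∈ T.support}, ?_, ?_, ?_, ?_⟩
      · rintro z (hz | rfl)
        · exact hS₁ (hP z hz)
        · exact hvS
      · rintro z (hz | hz)
        · exact hS₂ (hQS z (hQ₁Q z (Q₁.support_takeUntil_subset_support hw hz)))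
        · exact (hR z (hTR z hz)).1
      · rw [Set.disjoint_left]
        rintro z (hz | rfl) (hz' | hz')
        · exact hPQ z hz (hQ₁Q z (Q₁.support_takeUntil_subset_support hw hz'))
        · obtain rfl := hT z hz' (Or.inl hz)
          exact hPQ z hz (hQ₁Q z hw)
        · exact hvw hz'
        · exact (hR z (hTR z hz')).2 rfl
      · exact Linked.trans (y := u) ⟨P, fun z hz => Or.inl hz⟩
          (.of_adj huv (Or.inl P.end_mem_support) (Or.inr rfl))
      · exact Linked.trans (y := w) ⟨_, fun z hz => Or.inl hz⟩
          ⟨T.reverse, fun z hz => Or.inr (by simpa using hz)⟩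

/-- Menger's theorem for two paths: if no vertex separates `X` from `Y` in `S`, then `S` contains
two disjoint links from `X` to `Y`, each meeting `X` and `Y` only in its ends. -/
theorem menger_two {S X Y : Set V} (h : ∀ v, ∃ x ∈ X, ∃ y ∈ Y, Linked G (S \ {v}) x y)
    (hX : X.Nonempty) :
    ∃ x₁ ∈ X, ∃ y₁ ∈ Y, ∃ x₂ ∈ X, ∃ y₂ ∈ Y, ∃ S₁ ⊆ S, ∃ S₂ ⊆ S,
      Disjoint S₁ S₂ ∧ Linked G S₁ x₁ y₁ ∧ Linked G S₂ x₂ y₂ ∧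
      S₁ ∩ X ⊆ {x₁} ∧ S₁ ∩ Y ⊆ {y₁} ∧ S₂ ∩ X ⊆ {x₂} ∧ S₂ ∩ Y ⊆ {y₂} := by
  -- The initial pair is a one-vertex link `{x}` and a link avoiding `x`.
  obtain ⟨x₀, -⟩ := hX
  obtain ⟨x, hx, y, hy, p, hp⟩ := h x₀
  obtain ⟨x', hx', y', hy', q, hq⟩ := h x
  obtain ⟨x₁, hx₁, y₁, hy₁, x₂, hx₂, y₂, hy₂, S₁, hS₁, S₂, hS₂, hd, h1, h2⟩ :=
    menger_two_aux h p hy (fun z hz => (hp z hz).1)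
      ⟨x, hx, x', hx', y', hy', {x}, by simpa using (hp x p.start_mem_support).1,
        {z | z ∈ q.support}, fun z hz => (hq z hz).1,
        by simpa using fun hz => (hq x hz).2 rfl, .refl rfl, .of_walk q⟩
  obtain ⟨a, ha, b, hb, T₁, hT₁, l1, e1, e2⟩ := h1.trim hx₁ hy₁
  obtain ⟨c, hc, d, hd', T₂, hT₂, l2, e3, e4⟩ := h2.trim hx₂ hy₂
  exact ⟨a, ha, b, hb, c, hc, d, hd', T₁, hT₁.trans hS₁, T₂, hT₂.trans hS₂,
    hd.mono hT₁ hT₂, l1, l2, e1, e2, e3, e4⟩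

theorem isPath_append {u v w : V} {p : G.Walk u v} {q : G.Walk v w} (hp : p.IsPath)
    (hq : q.IsPath) (h : ∀ x ∈ p.support, x ∈ q.support → x = v) : (p.append q).IsPath := by
  induction p with
  | nil => simpa using hq
  | cons huv p ih =>
    rw [Walk.cons_isPath_iff] at hp
    rw [Walk.cons_append, Walk.cons_isPath_iff]
    refine ⟨ih hp.1 hq fun x hx hx' => h x (by simp [hx]) hx', fun hu => ?_⟩
    rw [Walk.mem_support_append_iff] at hu
    rcases hu with hu | hu
    · exact hp.2 hu
    · exact hp.2 (h _ (by simp) hu ▸ p.end_mem_support)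

theorem eq_of_mem_append {u v w x : V} {p : G.Walk u v} {q : G.Walk v w}
    (h : (p.append q).IsPath) (hp : x ∈ p.support) (hq : x ∈ q.support) : x = v := by
  by_contra hne
  exact h.ne_of_mem_support_of_append hne hp hq rfl

/-! ### Gluing trees and tree decompositions -/

theorem isAcyclic_sum {α β : Type*} {G : SimpleGraph α} {H : SimpleGraph β} (hG : G.IsAcyclic)
    (hH : H.IsAcyclic) : (G ⊕g H).IsAcyclic := by
  rintro (u | u) c hc
  · have hs : ∀ x ∈ c.support, x ∈ Set.range (Sum.inl : α → α ⊕ β) := by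
      rintro (x | x) hx
      · exact ⟨x, rfl⟩
      · classical exact absurd ⟨c.takeUntil _ hx⟩ (not_reachable_sum_inl_inr _ _)
    let f : (G ⊕g H).induce (Set.range (Sum.inl : α → α ⊕ β)) →g G :=
      { toFun := fun x => Sum.elim id (fun _ => u) x.1
        map_rel' := by
          rintro ⟨_, x, rfl⟩ ⟨_, y, rfl⟩ h
          simpa using h }
    have hf : Function.Injective f := by
      rintro ⟨_, x, rfl⟩ ⟨_, y, rfl⟩ h
      exact Subtype.ext (congrArg Sum.inl h)
    exact IsAcyclic.comap f hf hG (c.induce _ hs)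
      (Walk.IsCycle.of_map (f := (Embedding.induce _).toHom) (by rwa [Walk.map_induce]))
  · have hs : ∀ x ∈ c.support, x ∈ Set.range (Sum.inr : β → α ⊕ β) := by
      rintro (x | x) hx
      · classical
        exact absurd (Reachable.symm ⟨c.takeUntil _ hx⟩) (not_reachable_sum_inl_inr _ _)
      · exact ⟨x, rfl⟩
    let f : (G ⊕g H).induce (Set.range (Sum.inr : β → α ⊕ β)) →g H :=
      { toFun := fun x => Sum.elim (fun _ => u) id x.1
        map_rel' := by
          rintro ⟨_, x, rfl⟩ ⟨_, y, rfl⟩ h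
          simpa using h }
    have hf : Function.Injective f := by
      rintro ⟨_, x, rfl⟩ ⟨_, y, rfl⟩ h
      exact Subtype.ext (congrArg Sum.inr h)
    exact IsAcyclic.comap f hf hH (c.induce _ hs)
      (Walk.IsCycle.of_map (f := (Embedding.induce _).toHom) (by rwa [Walk.map_induce]))

theorem isTree_sum_sup_edge {α β : Type*} {G : SimpleGraph α} {H : SimpleGraph β} (hG : G.IsTree)
    (hH : H.IsTree) (a : α) (b : β) : ((G ⊕g H) ⊔ edge (Sum.inl a) (Sum.inr b)).IsTree :=
  ⟨hG.connected.sum_sup_edge hH.connected,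
    (isAcyclic_sum hG.isAcyclic hH.isAcyclic).sup_edge_of_not_reachable
      (not_reachable_sum_inl_inr _ _)⟩

theorem Linked.map {α β : Type*} {T : SimpleGraph α} {T' : SimpleGraph β} {S : Set α} {S' : Set β}
    {x y : α} (h : Linked T S x y) (f : T →g T') (hf : ∀ z ∈ S, f z ∈ S') :
    Linked T' S' (f x) (f y) := by
  obtain ⟨p, hp⟩ := h
  refine ⟨p.map f, fun z hz => ?_⟩
  rw [Walk.support_map, List.mem_map] at hz
  obtain ⟨w, hw, rfl⟩ := hz
  exact hf w (hp w hw)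

/-- `G[S]` has a tree decomposition with bags of size at most `n`, one of which contains `X`. -/
def HasDecomp (G : SimpleGraph V) (S X : Set V) (n : ℕ) : Prop :=
  ∃ (ι : Type) (_ : Finite ι) (T : SimpleGraph ι) (bag : ι → Set V) (r : ι),
    T.IsTree ∧ X ⊆ bag r ∧ (∀ i, bag i ⊆ S) ∧ (∀ i, (bag i).ncard ≤ n) ∧
    (∀ v ∈ S, ∃ i, v ∈ bag i) ∧
    (∀ v i j, v ∈ bag i → v ∈ bag j → Linked T {l | v ∈ bag l} i j) ∧
    ∀ u ∈ S, ∀ v ∈ S, G.Adj u v → ∃ i, u ∈ bag i ∧ v ∈ bag i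

theorem HasDecomp.single {X : Set V} {n : ℕ} (h : X.ncard ≤ n) : HasDecomp G X X n :=
  ⟨Unit, inferInstance, ⊥, fun _ => X, (), .of_subsingleton, subset_rfl, fun _ => subset_rfl,
    fun _ => h, fun _ hv => ⟨(), hv⟩, fun _ _ _ hi _ => .refl hi,
    fun _ hu _ hv _ => ⟨(), hu, hv⟩⟩

/-- Two tree decompositions can be glued along bags that contain the common vertices. -/
theorem HasDecomp.glue {S₁ S₂ X₁ X₂ : Set V} {n : ℕ} (h₁ : HasDecomp G S₁ X₁ n)
    (h₂ : HasDecomp G S₂ X₂ n) (hX₁ : S₁ ∩ S₂ ⊆ X₁) (hX₂ : S₁ ∩ S₂ ⊆ X₂)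
    (hadj : ∀ u ∈ S₁, ∀ v ∈ S₂, G.Adj u v → u ∈ S₂ ∨ v ∈ S₁) :
    HasDecomp G (S₁ ∪ S₂) X₁ n := by
  obtain ⟨ι₁, _, T₁, bag₁, r₁, tree₁, root₁, sub₁, card₁, cov₁, conn₁, edge₁⟩ := h₁
  obtain ⟨ι₂, _, T₂, bag₂, r₂, tree₂, root₂, sub₂, card₂, cov₂, conn₂, edge₂⟩ := h₂
  set T := (T₁ ⊕g T₂) ⊔ edge (Sum.inl r₁) (Sum.inr r₂) with hT
  let f₁ : T₁ →g T := (Hom.ofLE le_sup_left).comp Embedding.sumInl.toHom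
  let f₂ : T₂ →g T := (Hom.ofLE le_sup_left).comp Embedding.sumInr.toHom
  have hmid : T.Adj (Sum.inl r₁) (Sum.inr r₂) := Or.inr (by simp [edge_adj])
  have hl : ∀ v i j, v ∈ bag₁ i → v ∈ bag₁ j →
      Linked T {l | v ∈ Sum.elim bag₁ bag₂ l} (Sum.inl i) (Sum.inl j) :=
    fun v i j hi hj => (conn₁ v i j hi hj).map f₁ fun z hz => hz
  have hr : ∀ v i j, v ∈ bag₂ i → v ∈ bag₂ j →
      Linked T {l | v ∈ Sum.elim bag₁ bag₂ l} (Sum.inr i) (Sum.inr j) :=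
    fun v i j hi hj => (conn₂ v i j hi hj).map f₂ fun z hz => hz
  -- A common vertex lies in both root bags, so its two subtrees are joined by the new edge.
  have hlr : ∀ v i j, v ∈ bag₁ i → v ∈ bag₂ j →
      Linked T {l | v ∈ Sum.elim bag₁ bag₂ l} (Sum.inl i) (Sum.inr j) := by
    intro v i j hi hj
    have h1 : v ∈ bag₁ r₁ := root₁ (hX₁ ⟨sub₁ i hi, sub₂ j hj⟩)
    have h2 : v ∈ bag₂ r₂ := root₂ (hX₂ ⟨sub₁ i hi, sub₂ j hj⟩)
    exact ((hl v i r₁ hi h1).trans (.of_adj hmid h1 h2)).trans (hr v r₂ j h2 hj)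
  refine ⟨ι₁ ⊕ ι₂, inferInstance, T, Sum.elim bag₁ bag₂, Sum.inl r₁, isTree_sum_sup_edge tree₁ tree₂ _ _,
    root₁, ?_, ?_, ?_, ?_, ?_⟩
  · rintro (i | i)
    · exact (sub₁ i).trans Set.subset_union_left
    · exact (sub₂ i).trans Set.subset_union_right
  · rintro (i | i)
    · exact card₁ i
    · exact card₂ i
  · rintro v (hv | hv)
    · obtain ⟨i, hi⟩ := cov₁ v hv
      exact ⟨.inl i, hi⟩
    · obtain ⟨i, hi⟩ := cov₂ v hv
      exact ⟨.inr i, hi⟩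
  · rintro v (i | i) (j | j) hi hj
    · exact hl v i j hi hj
    · exact hlr v i j hi hj
    · exact (hlr v j i hj hi).symm
    · exact hr v i j hi hj
  · have e₁ : ∀ u ∈ S₁, ∀ v ∈ S₁, G.Adj u v →
        ∃ i, u ∈ Sum.elim bag₁ bag₂ i ∧ v ∈ Sum.elim bag₁ bag₂ i := fun u hu v hv h => by
      obtain ⟨i, hi⟩ := edge₁ u hu v hv h
      exact ⟨.inl i, hi⟩
    have e₂ : ∀ u ∈ S₂, ∀ v ∈ S₂, G.Adj u v →
        ∃ i, u ∈ Sum.elim bag₁ bag₂ i ∧ v ∈ Sum.elim bag₁ bag₂ i := fun u hu v hv h => by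
      obtain ⟨i, hi⟩ := edge₂ u hu v hv h
      exact ⟨.inr i, hi⟩
    rintro u (hu | hu) v (hv | hv) huv
    · exact e₁ u hu v hv huv
    · rcases hadj u hu v hv huv with h | h
      · exact e₂ u h v hv huv
      · exact e₁ u hu v h huv
    · rcases hadj v hv u hu huv.symm with h | h
      · exact e₂ u hu v h huv
      · exact e₁ u h v hv huv
    · exact e₂ u hu v hv huv

theorem HasDecomp.treewidth_le [Finite V] {X : Set V} {n : ℕ}
    (h : HasDecomp G Set.univ X n) : treewidth G ≤ (n : ℤ) - 1 := by
  classical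
  obtain ⟨ι, _, T, bag, r, tree, -, -, card, cov, conn, hedge⟩ := h
  obtain ⟨m, ⟨e⟩⟩ := Finite.exists_equiv_fin ι
  let φ : T ≃g T.map e.toEmbedding := Iso.map e T
  let D : TreeDecomposition G (T.map e.toEmbedding) :=
    { isTree := φ.isTree_iff.1 tree
      bag := fun i => (Set.toFinite (bag (e.symm i))).toFinset
      vertex_mem := fun v => by
        obtain ⟨i, hi⟩ := cov v trivial
        exact ⟨e i, by simpa using hi⟩
      edge_mem := fun u v huv => by
        obtain ⟨i, hi⟩ := hedge u trivial v trivial huv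
        exact ⟨e i, by simpa using hi⟩
      connected := fun v => by
        obtain ⟨i, hi⟩ := cov v trivial
        have : Nonempty {i | v ∈ (Set.toFinite (bag (e.symm i))).toFinset} :=
          ⟨⟨e i, by simpa using hi⟩⟩
        refine ⟨?_⟩
        rintro ⟨a, ha⟩ ⟨b, hb⟩
        have hab := conn v (e.symm a) (e.symm b) (by simpa using ha) (by simpa using hb)
        have := hab.map φ.toHom (S' := {i | v ∈ (Set.toFinite (bag (e.symm i))).toFinset})
          (fun z hz => by simpa [φ] using hz)
        have ea : φ.toHom (e.symm a) = a := by simp [φ]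
        have eb : φ.toHom (e.symm b) = b := by simp [φ]
        rw [ea, eb] at this
        obtain ⟨p, hp⟩ := this
        exact ⟨p.induce _ hp⟩ }
  refine ((isLeast_treewidth G).2 ⟨m, _, D, rfl⟩).trans ?_
  have : (Finset.univ.sup fun i => (D.bag i).card) ≤ n := Finset.sup_le fun i _ => by
    have := card (e.symm i)
    rwa [Set.ncard_eq_toFinset_card _ (Set.toFinite _)] at this
  unfold TreeDecomposition.width
  omega

/-! ### Outer neighbours, components, and decomposition by deleting vertices -/

/-- The vertices outside `C` with a neighbour in `C`. -/
def outerNbr (G : SimpleGraph V) (C : Set V) : Set V := {v | v ∉ C ∧ ∃ c ∈ C, G.Adj c v}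

/-- `D` is the vertex set of a connected component of `G[U]`. -/
structure IsComp (G : SimpleGraph V) (U D : Set V) : Prop where
  subset : D ⊆ U
  nonempty : D.Nonempty
  linked : ∀ x ∈ D, ∀ y ∈ D, Linked G D x y
  closed : ∀ x ∈ D, ∀ y ∈ U, G.Adj x y → y ∈ D

theorem exists_isComp {U : Set V} {x : V} (hx : x ∈ U) : ∃ D, IsComp G U D ∧ x ∈ D := by
  classical
  have key : ∀ y, Linked G U x y → Linked G {z | Linked G U x z} x y := by
    rintro y ⟨p, hp⟩
    exact ⟨p, fun z hz => ⟨p.takeUntil z hz, fun w hw =>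
      hp w (p.support_takeUntil_subset_support hz hw)⟩⟩
  refine ⟨{z | Linked G U x z}, ⟨fun y hy => hy.right_mem, ⟨x, .refl hx⟩, ?_, ?_⟩, .refl hx⟩
  · exact fun y hy z hz => (key y hy).symm.trans (key z hz)
  · exact fun y hy z hz hyz => hy.trans (.of_adj hyz hy.right_mem hz)

theorem IsComp.outerNbr_inter {U D : Set V} (h : IsComp G U D) {v : V} (hv : v ∈ outerNbr G D) :
    v ∉ U := by
  obtain ⟨hvD, d, hd, hdv⟩ := hv
  exact fun hvU => hvD (h.closed d hd v hvU hdv)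

/-- If every set with property `P` has few outer neighbours and can be broken up by a vertex into
components with property `P`, then the treewidth is small. -/
theorem hasDecomp_of_step [Finite V] {N : ℕ} {P : Set V → Prop}
    (hcard : ∀ C, P C → (outerNbr G C).ncard ≤ N)
    (hstep : ∀ C, P C → ∃ σ ∈ C, ∀ D, IsComp G (C \ {σ}) D → P D) (U X : Set V)
    (hUX : Disjoint U X) (hU : ∀ D, IsComp G U D → P D) (hX : outerNbr G U ⊆ X)
    (hXN : X.ncard ≤ N + 1) : HasDecomp G (U ∪ X) X (N + 1) := by
  induction hn : U.ncard using Nat.strong_induction_on generalizing U X with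
  | _ n ih =>
  subst hn
  rcases U.eq_empty_or_nonempty with rfl | ⟨x, hx⟩
  · simpa using HasDecomp.single hXN
  obtain ⟨D, hD, -⟩ := exists_isComp (G := G) hx
  -- The induction is on `|U|`: one component `D` is split off, decomposed separately with root bag
  -- containing `N(D) ∪ {σ}`, and glued back along `N(D) ⊆ X`.
  have hrest : HasDecomp G (U \ D ∪ X) X (N + 1) := by
    refine ih _ ?_ _ _ (hUX.mono_left Set.sdiff_subset) ?_ ?_ hXN rfl
    · obtain ⟨d, hd⟩ := hD.nonempty
      exact Set.ncard_lt_ncard ⟨Set.sdiff_subset, fun h => (h (hD.subset hd)).2 hd⟩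
    · refine fun E hE => hU E ⟨hE.subset.trans Set.sdiff_subset, hE.nonempty, hE.linked, ?_⟩
      intro x hx y hy hxy
      refine hE.closed x hx y ⟨hy, fun hyD => ?_⟩ hxy
      exact (hE.subset hx).2 (hD.closed y hyD x (hE.subset hx).1 hxy.symm)
    · rintro v ⟨hv, c, hc, hcv⟩
      refine hX ⟨fun hvU => ?_, c, hc.1, hcv⟩
      by_cases hvD : v ∈ D
      · exact hc.2 (hD.closed v hvD c hc.1 hcv.symm)
      · exact hv ⟨hvU, hvD⟩
  obtain ⟨σ, hσ, hσD⟩ := hstep D (hU D hD)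
  have hcomp : HasDecomp G (D \ {σ} ∪ insert σ (outerNbr G D)) (insert σ (outerNbr G D)) (N + 1) := by
    refine ih _ ?_ _ _ ?_ hσD ?_ ?_ rfl
    · exact Set.ncard_lt_ncard ⟨fun y hy => hD.subset hy.1, fun h => (h (hD.subset hσ)).2 rfl⟩
    · rw [Set.disjoint_left]
      rintro y ⟨hyD, hyσ⟩ (rfl | hy)
      · exact hyσ rfl
      · exact hy.1 hyD
    · rintro v ⟨hv, c, hc, hcv⟩
      by_cases hvσ : v = σ
      · exact Or.inl hvσ
      · exact Or.inr ⟨fun hvD => hv ⟨hvD, hvσ⟩, c, hc.1, hcv⟩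
    · exact (Set.ncard_insert_le _ _).trans (Nat.succ_le_succ (hcard D (hU D hD)))
  have hS : D \ {σ} ∪ insert σ (outerNbr G D) = D ∪ outerNbr G D := by
    ext y
    by_cases hy : y = σ
    · subst hy; simp [hσ]
    · simp [hy]
  rw [hS] at hcomp
  have hout : ∀ v ∈ outerNbr G D, v ∈ X := fun v hv =>
    hX ⟨hD.outerNbr_inter hv, hv.2.imp fun c hc => ⟨hD.subset hc.1, hc.2⟩⟩
  have hU' : U ∪ X = U \ D ∪ X ∪ (D ∪ outerNbr G D) := by
    ext y
    have := hout y
    have := @hD.subset y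
    simp only [Set.mem_union, Set.mem_sdiff]
    tauto
  rw [hU']
  refine hrest.glue hcomp ?_ ?_ ?_
  · rintro y ⟨(hy | hy), (hy' | hy')⟩
    · exact absurd hy' hy.2
    · exact hout y hy'
    · exact hy
    · exact hy
  · rintro y ⟨(hy | hy), (hy' | hy')⟩
    · exact absurd hy' hy.2
    · exact Or.inr hy'
    · exact absurd hy (Set.disjoint_left.1 hUX (hD.subset hy'))
    · exact Or.inr hy'
  · rintro u hu v (hv | hv) huv
    · left
      by_cases huD : u ∈ D
      · exact Or.inl huD
      · exact Or.inr ⟨huD, v, hv, huv.symm⟩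
    · exact Or.inr (Or.inr (hout v hv))

theorem exists_mem_outerNbr {D : Set V} {u v : V} (p : G.Walk u v) (hu : u ∈ D) (hv : v ∉ D) :
    ∃ x ∈ p.support, x ∈ outerNbr G D := by
  induction p with
  | nil => exact absurd hu hv
  | @cons a b c hab p ih =>
    by_cases hb : b ∈ D
    · obtain ⟨x, hx, hxD⟩ := ih hb hv
      exact ⟨x, by simp [hx], hxD⟩
    · exact ⟨b, by simp, hb, a, hu, hab⟩

/-- A set avoiding `s` and `t` that contains an inner vertex of an `s`-`t` path has two outer
neighbours. -/
theorem exists_ne_mem_outerNbr {D : Set V} {s t v : V} {p : G.Walk s t} (hp : p.IsPath)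
    (hvp : v ∈ p.support) (hv : v ∈ D) (hs : s ∉ D) (ht : t ∉ D) :
    ∃ x ∈ outerNbr G D, ∃ y ∈ outerNbr G D, x ≠ y := by
  obtain ⟨q, r, rfl⟩ := p.mem_support_iff_exists_append.1 hvp
  obtain ⟨x, hx, hxD⟩ := exists_mem_outerNbr q.reverse hv hs
  obtain ⟨y, hy, hyD⟩ := exists_mem_outerNbr r hv ht
  refine ⟨x, hxD, y, hyD, ?_⟩
  rintro rfl
  exact hxD.1 (eq_of_mem_append hp (by simpa using hx) hy ▸ hv)

/-! ### Frames and their extension -/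

/-- Disjoint paths from `s` and `t` that avoid `C`, cover its outer neighbours and end in outer
neighbours of `C`. -/
structure Frame (G : SimpleGraph V) {s t a b : V} (A : G.Walk s a) (B : G.Walk t b)
    (C : Set V) : Prop where
  isPath_left : A.IsPath
  isPath_right : B.IsPath
  disjoint : ∀ x ∈ A.support, x ∉ B.support
  left_notMem : ∀ x ∈ A.support, x ∉ C
  right_notMem : ∀ x ∈ B.support, x ∉ C
  cover : ∀ v ∈ outerNbr G C, v ∈ A.support ∨ v ∈ B.support
  left_end : a ∈ outerNbr G C
  right_end : b ∈ outerNbr G C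

theorem Frame.symm {C : Set V} {s t a b : V} {A : G.Walk s a} {B : G.Walk t b}
    (h : Frame G A B C) : Frame G B A C :=
  ⟨h.isPath_right, h.isPath_left, fun x hx hx' => h.disjoint x hx' hx, h.right_notMem,
    h.left_notMem, fun v hv => (h.cover v hv).symm, h.right_end, h.left_end⟩

/-- `C` has a frame. -/
def Framed (G : SimpleGraph V) (s t : V) (C : Set V) : Prop :=
  ∃ (a b : V) (A : G.Walk s a) (B : G.Walk t b), Frame G A B C

theorem Framed.symm {C : Set V} {s t : V} (h : Framed G s t C) : Framed G t s C := by
  obtain ⟨a, b, A, B, h⟩ := h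
  exact ⟨b, a, B, A, h.symm⟩

/-- Cutting `A` behind its last vertex in `X` loses no vertex of `X`. In this way a frame for a
smaller set is made to end in outer neighbours again. -/
theorem exists_truncate {s a : V} {A : G.Walk s a} (hA : A.IsPath) {X : Set V}
    (h : ∃ x ∈ A.support, x ∈ X) :
    ∃ a' ∈ X, ∃ A' : G.Walk s a', A'.IsPath ∧ (∀ x ∈ A'.support, x ∈ A.support) ∧
      ∀ x ∈ A.support, x ∈ X → x ∈ A'.support := by
  obtain ⟨x, hx, q, r, hqr, hq⟩ := exists_append_first A.reverse X (by simpa using h)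
  have hmem : ∀ z, z ∈ A.support ↔ z ∈ q.support ∨ z ∈ r.support := fun z => by
    rw [← Walk.mem_support_append_iff, ← hqr, Walk.support_reverse, List.mem_reverse]
  have hr : (q.append r).IsPath := hqr ▸ hA.reverse
  refine ⟨x, hx, r.reverse, hr.of_append_right.reverse, fun z hz => ?_, fun z hz hzX => ?_⟩
  · exact (hmem z).2 (Or.inr (by simpa using hz))
  · rcases (hmem z).1 hz with h | h
    · rw [hq z h hzX]
      simp
    · simpa using h

theorem Framed.of_isPath {C : Set V} {s t a b : V} {A : G.Walk s a} {B : G.Walk t b}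
    (hA : A.IsPath) (hB : B.IsPath) (hAB : ∀ x ∈ A.support, x ∉ B.support)
    (hAC : ∀ x ∈ A.support, x ∉ C) (hBC : ∀ x ∈ B.support, x ∉ C)
    (hcov : ∀ v ∈ outerNbr G C, v ∈ A.support ∨ v ∈ B.support)
    (hAx : ∃ x ∈ A.support, x ∈ outerNbr G C) (hBx : ∃ x ∈ B.support, x ∈ outerNbr G C) :
    Framed G s t C := by
  obtain ⟨a', ha', A', hA', hA's, hA'X⟩ := exists_truncate hA hAx
  obtain ⟨b', hb', B', hB', hB's, hB'X⟩ := exists_truncate hB hBx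
  exact ⟨a', b', A', B', hA', hB', fun x hx hx' => hAB x (hA's x hx) (hB's x hx'),
    fun x hx => hAC x (hA's x hx), fun x hx => hBC x (hB's x hx),
    fun v hv => (hcov v hv).imp (hA'X v · hv) (hB'X v · hv), ha', hb'⟩

theorem IsComp.outerNbr_diff_subset {C D : Set V} {σ : V} (hD : IsComp G (C \ {σ}) D) :
    outerNbr G D ⊆ insert σ (outerNbr G C) := by
  intro v hv
  by_cases hvσ : v = σ
  · exact Or.inl hvσ
  · exact Or.inr ⟨fun hvC => hD.outerNbr_inter hv ⟨hvC, hvσ⟩,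
      hv.2.imp fun c hc => ⟨(hD.subset hc.1).1, hc.2⟩⟩

theorem IsComp.mem_outerNbr {C D : Set V} {σ : V} (hC : ∀ x ∈ C, ∀ y ∈ C, Linked G C x y)
    (hσ : σ ∈ C) (hD : IsComp G (C \ {σ}) D) : σ ∈ outerNbr G D := by
  obtain ⟨d, hd⟩ := hD.nonempty
  obtain ⟨p, hp⟩ := hC d (hD.subset hd).1 σ hσ
  obtain ⟨x, hx, hxD⟩ := exists_mem_outerNbr p hd fun h => (hD.subset h).2 rfl
  rcases hD.outerNbr_diff_subset hxD with rfl | h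
  · exact hxD
  · exact absurd (hp x hx) h.1

/-- A walk in `C` can enter `D` from outside only through `σ`, so it reaches `σ` first. -/
theorem IsComp.linked_diff {C D : Set V} {σ y : V} (hC : ∀ x ∈ C, ∀ y ∈ C, Linked G C x y)
    (hσ : σ ∈ C) (hD : IsComp G (C \ {σ}) D) (hy : y ∈ C) (hyD : y ∉ D) :
    Linked G (C \ D) y σ := by
  obtain ⟨p, hp⟩ := hC y hy σ hσ
  clear hC
  induction p with
  | nil => exact .refl ⟨hy, hyD⟩
  | @cons a b c hab p ih =>
    have hb : b ∈ C := hp b (by simp)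
    by_cases hac : a = c
    · subst hac; exact .refl ⟨hy, hyD⟩
    · have hbD : b ∉ D := fun hbD => hyD (hD.closed b hbD a ⟨hy, hac⟩ hab.symm)
      exact Linked.trans (.of_adj hab ⟨hy, hyD⟩ ⟨hb, hbD⟩)
        (ih hσ hD hb hbD fun z hz => hp z (by simp [hz]))

/-- The neighbours of `a` in `C` are outside `D`, hence linked to `σ` outside `D`. This lets a frame
path whose end is not attached to `D` be prolonged to `σ`. -/
theorem IsComp.linked_insert {C D : Set V} {σ a : V} (hC : ∀ x ∈ C, ∀ y ∈ C, Linked G C x y)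
    (hσ : σ ∈ C) (hD : IsComp G (C \ {σ}) D) (ha : a ∈ outerNbr G C) (haD : a ∉ outerNbr G D) :
    Linked G (insert a (C \ D)) a σ := by
  obtain ⟨haC, c, hc, hca⟩ := ha
  have hcD : c ∉ D := fun h => haD ⟨fun h' => haC (hD.subset h').1, c, h, hca⟩
  exact Linked.trans (.of_adj hca.symm (Or.inl rfl) (Or.inr ⟨hc, hcD⟩))
    ((hD.linked_diff hC hσ hc hcD).mono (Set.subset_insert _ _))

theorem exists_extension {K : Set V} {s a σ : V} {A : G.Walk s a} (hA : A.IsPath)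
    (hAK : ∀ x ∈ A.support, x ∉ K) (h : Linked G (insert a K) a σ) :
    ∃ A' : G.Walk s σ, A'.IsPath ∧ (∀ x ∈ A.support, x ∈ A'.support) ∧
      ∀ x ∈ A'.support, x ∈ A.support ∨ x ∈ K := by
  obtain ⟨q, hq, hqK⟩ := h.exists_isPath
  refine ⟨A.append q, isPath_append hA hq fun x hx hx' => ?_, fun x hx => by simp [hx],
    fun x hx => ?_⟩
  · exact (hqK x hx').resolve_right (hAK x hx)
  · rcases (Walk.mem_support_append_iff _ _).1 hx with hx | hx
    · exact Or.inl hx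
    · rcases hqK x hx with rfl | hx
      · exact Or.inl A.end_mem_support
      · exact Or.inr hx

/-- If `σ` can be reached from the end of `A` outside `D`, then the frame of `C` can be changed
into a frame of the component `D` of `C - σ`. -/
theorem Frame.framed_of_linked {C D : Set V} {s t a b σ : V} {A : G.Walk s a} {B : G.Walk t b}
    (h : Frame G A B C) (hrel : ∀ v, ∃ p : G.Walk s t, p.IsPath ∧ v ∈ p.support)
    (hC : ∀ x ∈ C, ∀ y ∈ C, Linked G C x y) (hσ : σ ∈ C) (hD : IsComp G (C \ {σ}) D)
    (hl : Linked G (insert a (C \ D)) a σ) : Framed G s t D := by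
  have hDC : D ⊆ C := fun x hx => (hD.subset hx).1
  have hσD := hD.mem_outerNbr hC hσ
  have hsub := hD.outerNbr_diff_subset
  by_cases hB : ∃ x ∈ B.support, x ∈ outerNbr G D
  · obtain ⟨A', hA', hsup, hin⟩ := exists_extension h.isPath_left
      (fun x hx hx' => h.left_notMem x hx hx'.1) hl
    refine Framed.of_isPath hA' h.isPath_right ?_ ?_ ?_ ?_ ⟨σ, A'.end_mem_support, hσD⟩ hB
    · rintro x hx hxB
      rcases hin x hx with hx | hx
      · exact h.disjoint x hx hxB
      · exact h.right_notMem x hxB hx.1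
    · rintro x hx hxD
      rcases hin x hx with hx | hx
      · exact h.left_notMem x hx (hDC hxD)
      · exact hx.2 hxD
    · exact fun x hx hxD => h.right_notMem x hx (hDC hxD)
    · intro v hv
      rcases hsub hv with rfl | hv
      · exact Or.inl A'.end_mem_support
      · exact (h.cover v hv).imp (hsup v) id
  -- If `B` misses `N(D)`, prolonging `A` would leave `B` no end in `N(D)`, so `B` is prolonged to
  -- `σ` instead.
  · obtain ⟨B', hB', hsup, hin⟩ := exists_extension h.isPath_right
      (fun x hx hx' => h.right_notMem x hx hx'.1)
      (hD.linked_insert hC hσ h.right_end fun hb => hB ⟨b, B.end_mem_support, hb⟩)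
    refine Framed.of_isPath h.isPath_left hB' ?_ ?_ ?_ ?_ ?_ ⟨σ, B'.end_mem_support, hσD⟩
    · rintro x hx hxB
      rcases hin x hxB with hx' | hx'
      · exact h.disjoint x hx hx'
      · exact h.left_notMem x hx hx'.1
    · exact fun x hx hxD => h.left_notMem x hx (hDC hxD)
    · rintro x hx hxD
      rcases hin x hx with hx | hx
      · exact h.right_notMem x hx (hDC hxD)
      · exact hx.2 hxD
    · intro v hv
      rcases hsub hv with rfl | hv
      · exact Or.inr B'.end_mem_support
      · exact (h.cover v hv).imp id (hsup v)
    -- `D` has two outer neighbours; one differs from `σ`, and as `B` misses it, it lies on `A`.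
    · obtain ⟨d, hd⟩ := hD.nonempty
      obtain ⟨p, hp, hdp⟩ := hrel d
      obtain ⟨x, hx, y, hy, hxy⟩ := exists_ne_mem_outerNbr hp hdp hd
        (fun hs => h.left_notMem s A.start_mem_support (hDC hs))
        (fun ht => h.right_notMem t B.start_mem_support (hDC ht))
      have key : ∀ z ∈ outerNbr G D, z ≠ σ → z ∈ A.support := fun z hz hzσ =>
        (h.cover z ((hsub hz).resolve_left hzσ)).resolve_right fun hzB => hB ⟨z, hzB, hz⟩
      by_cases hxσ : x = σ
      · exact ⟨y, key y hy fun e => hxy (hxσ.trans e.symm), hy⟩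
      · exact ⟨x, key x hx hxσ, hx⟩

/-! ### Detour inequalities -/

/-- If all `s`-`t` paths have length less than `dist s t + k`, then the distance from `s` grows
along every `s`-`t` path almost as fast as possible. -/
theorem dist_add_length_lt {s t x y : V} {k : ℕ}
    (hk : ∀ p : G.Walk s t, p.IsPath → p.length < G.dist s t + k) {S₁ S₃ : Set V}
    (h₁ : Linked G S₁ s x) {p : G.Walk x y} (hp : p.IsPath) (h₃ : Linked G S₃ y t)
    (h₁₂ : ∀ z ∈ p.support, z ∈ S₁ → z = x) (h₂₃ : ∀ z ∈ p.support, z ∈ S₃ → z = y)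
    (h₁₃ : ∀ z ∈ S₁, z ∉ S₃) : G.dist s x + p.length < G.dist s y + k := by
  obtain ⟨q, hq, hqS⟩ := h₁.exists_isPath
  obtain ⟨r, hr, hrS⟩ := h₃.exists_isPath
  -- The composite path bounds `d(s,x) + |p| + d(y,t)` strictly by `d(s,t) + k ≤ d(s,y) + d(y,t) +
  -- k`, and `d(y,t)` cancels.
  have h := hk (q.append (p.append r)) (isPath_append hq
    (isPath_append hp hr fun z hz hz' => h₂₃ z hz (hrS z hz')) fun z hz hz' => by
      rcases (Walk.mem_support_append_iff _ _).1 hz' with hz' | hz'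
      · exact h₁₂ z hz' (hqS z hz)
      · exact absurd (hrS z hz') (h₁₃ z (hqS z hz)))
  have h1 := dist_le q
  have h2 := dist_le r
  have h3 : G.dist s t ≤ G.dist s y + G.dist y t :=
    Reachable.dist_triangle_left ⟨q.append p⟩ t
  simp only [Walk.length_append] at h
  omega

/-- The vertices of `C` that lie on a path from `a` to `b` with inner vertices in `C`. -/
def between (G : SimpleGraph V) (a b : V) (C : Set V) : Set V :=
  {q | q ∈ C ∧ ∃ p : G.Walk a b, p.IsPath ∧ (∀ z ∈ p.support, z ∈ insert a (insert b C)) ∧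
    q ∈ p.support}

theorem mem_of_mem_walk {a b : V} {C : Set V} {p : G.Walk a b} (hp : p.IsPath)
    (h : ∀ z ∈ p.support, z ∈ insert a (insert b C)) :
    ∀ z ∈ p.support, z ∈ between G a b C ∪ {a, b} := by
  intro z hz
  rcases h z hz with rfl | rfl | hzC
  · simp
  · simp
  · exact Or.inl ⟨hzC, p, hp, h, hz⟩

/-- If no vertex of `C` separates `a` from `b`, then any two vertices of `between G a b C` can be
linked to `a` and `b` in one of two ways. -/
theorem exists_two_links {a b q₁ q₂ : V} {C : Set V} (ha : a ∉ C) (hb : b ∉ C) (hab : a ≠ b)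
    (hstar : ∀ σ ∈ C, Linked G (insert a (insert b C) \ {σ}) a b)
    (hq₁ : q₁ ∈ between G a b C) (hq₂ : q₂ ∈ between G a b C) (hq : q₁ ≠ q₂) :
    ∃ T ⊆ between G a b C ∪ {a, b}, ∃ T' ⊆ between G a b C ∪ {a, b}, Disjoint T T' ∧
      ((Linked G T q₂ q₁ ∧ Linked G T' a b) ∨ (Linked G T q₂ b ∧ Linked G T' a q₁)) := by
  obtain ⟨x₁, hx₁, y₁, hy₁, x₂, hx₂, y₂, hy₂, S₁, hS₁, S₂, hS₂, hd, h1, h2, -⟩ :=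
    menger_two (G := G) (S := between G a b C ∪ {a, b}) (X := {q₂, a}) (Y := {q₁, b})
      -- For `v ∈ C` an `a`-`b` path avoiding `v` remains. For `v = b` the part from `a` to `q₁` of
      -- a path through `q₁` is used, otherwise the part from `q₂` to `b` of one through `q₂`.
      (fun v => by
        by_cases hvC : v ∈ C
        · obtain ⟨p, hp, hps⟩ := (hstar v hvC).exists_isPath
          exact ⟨a, by simp, b, by simp, p, fun z hz =>
            ⟨mem_of_mem_walk hp (fun w hw => (hps w hw).1) z hz, (hps z hz).2⟩⟩
        by_cases hvb : v = b
        · obtain ⟨hqC, p, hp, hps, hqp⟩ := hq₁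
          obtain ⟨p₁, p₂, rfl⟩ := p.mem_support_iff_exists_append.1 hqp
          refine ⟨a, by simp, q₁, by simp, p₁, fun z hz =>
            ⟨mem_of_mem_walk hp hps z (by simp [hz]), ?_⟩⟩
          rintro rfl
          subst hvb
          exact hb (eq_of_mem_append hp hz p₂.end_mem_support ▸ hqC)
        · obtain ⟨hqC, p, hp, hps, hqp⟩ := hq₂
          obtain ⟨p₁, p₂, rfl⟩ := p.mem_support_iff_exists_append.1 hqp
          refine ⟨q₂, by simp, b, by simp, p₂, fun z hz =>
            ⟨mem_of_mem_walk hp hps z (by simp [hz]), ?_⟩⟩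
          rintro rfl
          rcases hps z (by simp [hz]) with rfl | h
          · exact ha (eq_of_mem_append hp p₁.start_mem_support hz ▸ hqC)
          · exact h.elim hvb hvC) ⟨a, by simp⟩
  have hx : x₁ ≠ x₂ := fun e => Set.disjoint_left.1 hd h1.left_mem (e ▸ h2.left_mem)
  have hy : y₁ ≠ y₂ := fun e => Set.disjoint_left.1 hd h1.right_mem (e ▸ h2.right_mem)
  rcases hx₁ with rfl | rfl <;> rcases hx₂ with rfl | rfl <;> rcases hy₁ with rfl | rfl <;>
    rcases hy₂ with rfl | rfl
  any_goals exact absurd rfl hx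
  any_goals exact absurd rfl hy
  · exact ⟨S₁, hS₁, S₂, hS₂, hd, Or.inl ⟨h1, h2⟩⟩
  · exact ⟨S₁, hS₁, S₂, hS₂, hd, Or.inr ⟨h1, h2⟩⟩
  · exact ⟨S₂, hS₂, S₁, hS₁, hd.symm, Or.inr ⟨h2, h1⟩⟩
  · exact ⟨S₂, hS₂, S₁, hS₁, hd.symm, Or.inl ⟨h2, h1⟩⟩

set_option maxHeartbeats 1000000 in
/-- Two vertices of the path `A`, far from its end, cannot be linked disjointly to two vertices of
`between G a b C` if there are no long detours. -/
theorem not_disjoint_links {s t a b z₁ z₂ q₁ q₂ : V} {k : ℕ} (hk0 : 0 < k)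
    (hk : ∀ p : G.Walk s t, p.IsPath → p.length < G.dist s t + k)
    {A₁ : G.Walk s z₁} {A₂ : G.Walk z₁ z₂} {A₃ : G.Walk z₂ a} {B : G.Walk t b} {C : Set V}
    (h : Frame G (A₁.append (A₂.append A₃)) B C) (hA₃ : 3 * k ≤ A₃.length)
    (hstar : ∀ σ ∈ C, Linked G (insert a (insert b C) \ {σ}) a b)
    (hq₁ : q₁ ∈ between G a b C) (hq₂ : q₂ ∈ between G a b C) {S₁ S₂ : Set V}
    (hS₁ : S₁ ⊆ insert z₁ C) (hS₂ : S₂ ⊆ insert z₂ C) (hd : Disjoint S₁ S₂)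
    (hl₁ : Linked G S₁ z₁ q₁) (hl₂ : Linked G S₂ z₂ q₂)
    (hg₁ : S₁ ∩ between G a b C ⊆ {q₁}) (hg₂ : S₂ ∩ between G a b C ⊆ {q₂}) : False := by
  have hd' : ∀ z ∈ S₁, z ∉ S₂ := fun z hz => Set.disjoint_left.1 hd hz
  have hz : z₁ ≠ z₂ := fun e => hd' z₁ hl₁.left_mem (e ▸ hl₂.left_mem)
  have hq : q₁ ≠ q₂ := fun e => hd' q₁ hl₁.right_mem (e ▸ hl₂.right_mem)
  have hA := h.isPath_left
  have hA23 := hA.of_append_right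
  have hA3 := hA23.of_append_right
  have hz₁A₃ : z₁ ∉ A₃.support := fun hm => hz (eq_of_mem_append hA23 A₂.start_mem_support hm)
  have h13 : ∀ z ∈ A₁.support, z ∉ A₃.support := fun z h1 h3 =>
    hz₁A₃ (eq_of_mem_append hA h1 (by simp [h3]) ▸ h3)
  have h23 : ∀ z ∈ A₂.support, z ∈ A₃.support → z = z₂ := fun z h2 h3 =>
    eq_of_mem_append hA23 h2 h3
  have hz₂A₁ : z₂ ∉ A₁.support := fun hm => h13 z₂ hm A₃.start_mem_support
  have haz₂ : a ≠ z₂ := by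
    rintro rfl
    have := Walk.length_eq_zero_iff.2 (Walk.isPath_iff_nil.1 hA3)
    omega
  have hmem : ∀ z, z ∈ A₁.support ∨ z ∈ A₂.support ∨ z ∈ A₃.support → z ∉ C ∧ z ∉ B.support :=
    fun z hz => ⟨h.left_notMem z (by simpa using hz), h.disjoint z (by simpa using hz)⟩
  have haC : a ∉ C := h.left_end.1
  have hbC : b ∉ C := h.right_end.1
  have hbB := B.end_mem_support
  have haA := A₃.end_mem_support
  have hzA₁ := A₁.end_mem_support
  have hzA₂ := A₂.end_mem_support
  have hzA₃ := A₃.start_mem_support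
  have hab : a ≠ b := fun e => (hmem a (by simp)).2 (e ▸ hbB)
  have hBC := h.right_notMem
  have hgC : ∀ z ∈ between G a b C, z ∉ A₁.support ∧ z ∉ A₂.support ∧ z ∉ A₃.support ∧
      z ∉ B.support ∧ z ≠ a ∧ z ≠ b ∧ z ≠ z₁ ∧ z ≠ z₂ := by
    rintro z ⟨hzC, -⟩
    refine ⟨fun hm => ?_, fun hm => ?_, fun hm => ?_, fun hm => hBC z hm hzC, ?_, ?_, ?_, ?_⟩
    · exact (hmem z (by simp [hm])).1 hzC
    · exact (hmem z (by simp [hm])).1 hzC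
    · exact (hmem z (by simp [hm])).1 hzC
    · rintro rfl; exact haC hzC
    · rintro rfl; exact hbC hzC
    · rintro rfl; exact (hmem z (by simp)).1 hzC
    · rintro rfl; exact (hmem z (by simp)).1 hzC
  have hlB : Linked G {z | z ∈ B.support} b t := (Linked.of_walk B).symm
  have hlA₁ : Linked G {z | z ∈ A₁.support} s z₁ := Linked.of_walk A₁
  -- the path `A` is traversed upwards
  have e₀ : G.dist s z₂ + A₃.length < G.dist s a + k := by
    refine dist_add_length_lt hk (S₁ := {z | z ∈ (A₁.append A₂).support})
      (S₃ := insert a (insert b C) ∪ {z | z ∈ B.support}) (.of_walk _) hA3 ?_ ?_ ?_ ?_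
    · obtain ⟨hqC, p, -, hp, -⟩ := hq₁
      exact Linked.trans (y := b) ⟨p, fun z hz => Or.inl (hp z hz)⟩
        (hlB.mono Set.subset_union_right)
    · intro z hz hz'
      rcases (Walk.mem_support_append_iff _ _).1 hz' with hz' | hz'
      · exact absurd hz (h13 z hz')
      · exact h23 z hz' hz
    · rintro z hz ((rfl | rfl | hz') | hz')
      · rfl
      · exact absurd hbB (hmem z (by simp [hz])).2
      · exact absurd hz' (hmem z (by simp [hz])).1
      · exact absurd hz' (hmem z (by simp [hz])).2
    · intro z hz hz'
      have hz12 := (Walk.mem_support_append_iff _ _).1 hz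
      have hzm := hmem z (by tauto)
      rcases hz' with (rfl | rfl | hz') | hz'
      · rcases hz12 with hz12 | hz12
        · exact h13 z hz12 haA
        · exact haz₂ (h23 z hz12 haA)
      · exact hzm.2 hbB
      · exact hzm.1 hz'
      · exact hzm.2 hz'
  -- Route: all of `A`, then an `a`-`b` path through `q₂`, then `B` backwards.
  have e₁ : G.dist s a < G.dist s q₂ + k := by
    obtain ⟨hqC, p, hp, hps, hqp⟩ := hq₂
    obtain ⟨p₁, p₂, rfl⟩ := p.mem_support_iff_exists_append.1 hqp
    refine (Nat.le_add_right _ p₁.length).trans_lt <| dist_add_length_lt hk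
      (S₁ := {z | z ∈ (A₁.append (A₂.append A₃)).support})
      (S₃ := {z | z ∈ p₂.support} ∪ {z | z ∈ B.support}) (.of_walk _) hp.of_append_left ?_ ?_ ?_ ?_
    · exact ((Linked.of_walk p₂).mono Set.subset_union_left).trans
        (hlB.mono Set.subset_union_right)
    · intro z hz hz'
      rcases hps z (by simp [hz]) with rfl | rfl | hzC
      · rfl
      · exact absurd hbB (h.disjoint z hz')
      · exact absurd hzC (h.left_notMem z hz')
    · rintro z hz (hz' | hz')
      · exact eq_of_mem_append hp hz hz'
      · rcases hps z (by simp [hz]) with rfl | rfl | hzC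
        · exact absurd hz' (hmem z (by simp)).2
        · exact eq_of_mem_append hp hz p₂.end_mem_support
        · exact absurd hzC (hBC z hz')
    · rintro z hz (hz' | hz')
      · rcases hps z (by simp [hz'.out]) with rfl | rfl | hzC
        · exact haC (eq_of_mem_append hp p₁.start_mem_support hz' ▸ hqC)
        · exact h.disjoint z hz hbB
        · exact h.left_notMem z hz hzC
      · exact h.disjoint z hz hz'
  have hS₁' : ∀ z ∈ S₁, z = z₁ ∨ z ∈ C := fun z hz => hS₁ hz
  have hS₂' : ∀ z ∈ S₂, z = z₂ ∨ z ∈ C := fun z hz => hS₂ hz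
  have hg₁' : ∀ z ∈ S₁, z ∈ between G a b C → z = q₁ := fun z hz hz' => hg₁ ⟨hz, hz'⟩
  have hg₂' : ∀ z ∈ S₂, z ∈ between G a b C → z = q₂ := fun z hz hz' => hg₂ ⟨hz, hz'⟩
  obtain ⟨T, hT, T', hT', hTT', hcase⟩ := exists_two_links haC hbC hab hstar hq₁ hq₂ hq
  have hTT : ∀ z ∈ T, z ∉ T' := fun z hz => Set.disjoint_left.1 hTT' hz
  have hT2 : ∀ z ∈ T, z ∈ between G a b C ∨ z = a ∨ z = b := fun z hz => hT hz
  have hT2' : ∀ z ∈ T', z ∈ between G a b C ∨ z = a ∨ z = b := fun z hz => hT' hz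
  rcases hcase with ⟨m₁, m₂⟩ | ⟨m₁, m₂⟩
  -- Route: `s`, `z₁`, `q₁`, `q₂`, `z₂`, along `A₃` to `a`, `b`, `t`. Then `d(s,q₂) < d(s,z₂) + k`,
  -- and with `e₀` and `e₁` this gives `|A₃| < 3k`.
  · have a1 := m₁.left_mem
    have a2 := m₁.right_mem
    have a3 := m₂.left_mem
    have a4 := m₂.right_mem
    obtain ⟨p, hp, hps⟩ := hl₂.symm.exists_isPath
    have e₂ := dist_add_length_lt hk (S₁ := {z | z ∈ A₁.support} ∪ S₁ ∪ T)
      (S₃ := {z | z ∈ A₃.support} ∪ T' ∪ {z | z ∈ B.support})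
      (((hlA₁.mono (by grind)).trans (hl₁.mono (by grind))).trans (m₁.symm.mono (by grind))) hp
      ((((Linked.of_walk A₃).mono (by grind)).trans (m₂.mono (by grind))).trans (hlB.mono (by grind)))
      (by
        rintro z hz ((hz' | hz') | hz')
        · grind
        · grind
        · grind)
      (by
        rintro z hz ((hz' | hz') | hz')
        · grind
        · grind
        · grind)
      (by
        rintro z ((hz | hz) | hz) ((hz' | hz') | hz') <;> grind)
    omega
  -- Route: `s`, `z₁`, `q₁`, `a`, back along `A₃` to `z₂`, `q₂`, `b`, `t`. Then `d(s,a) + |A₃| <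
  -- d(s,z₂) + k`, and adding `e₀` gives `|A₃| < k`.
  · have a1 := m₁.left_mem
    have a2 := m₁.right_mem
    have a3 := m₂.left_mem
    have a4 := m₂.right_mem
    have e₂ := dist_add_length_lt hk (S₁ := {z | z ∈ A₁.support} ∪ S₁ ∪ T')
      (S₃ := S₂ ∪ T ∪ {z | z ∈ B.support})
      (((hlA₁.mono (by grind)).trans (hl₁.mono (by grind))).trans (m₂.symm.mono (by grind)))
      hA3.reverse
      (((hl₂.mono (by grind)).trans (m₁.mono (by grind))).trans (hlB.mono (by grind)))
      (by
        rintro z hz ((hz' | hz') | hz') <;> rw [Walk.support_reverse, List.mem_reverse] at hz <;>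
        grind)
      (by
        rintro z hz ((hz' | hz') | hz') <;> rw [Walk.support_reverse, List.mem_reverse] at hz <;>
        grind)
      (by
        rintro z ((hz | hz) | hz) ((hz' | hz') | hz') <;> grind)
    rw [Walk.length_reverse] at e₂
    omega

/-! ### Separating vertices, fans, and rerouting the frame -/

/-- Every link from `Z` to `Y` inside `C ∪ Z` passes through `x`. -/
def Separates (G : SimpleGraph V) (C Z Y : Set V) (x : V) : Prop :=
  ∀ z ∈ Z, ∀ y ∈ Y, ¬Linked G ((C ∪ Z) \ {x}) z y

theorem exists_linked_adj {K : Set V} {z x : V} (h : Linked G (insert x K) z x) (hzx : z ≠ x) :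
    ∃ y, G.Adj y x ∧ Linked G (K \ {x}) z y := by
  obtain ⟨p, hp, hpS⟩ := h.symm.exists_isPath
  cases p with
  | nil => exact absurd rfl hzx
  | @cons _ y _ hxy p =>
    rw [Walk.cons_isPath_iff] at hp
    refine ⟨y, hxy.symm, Linked.symm ⟨p, fun w hw => ?_⟩⟩
    have hwx : w ≠ x := fun e => hp.2 (e ▸ hw)
    exact ⟨(hpS w (by simp [hw])).resolve_left hwx, hwx⟩

/-- If some vertex separates `Z` from `Y`, then some vertex `x` of `C` does so and is joined to
two vertices of `Z` by links that share only `x`. -/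
theorem exists_separates_fan [Finite V] {C Z Y : Set V} (hC : ∀ x ∈ C, ∀ y ∈ C, Linked G C x y)
    (hZC : ∀ z ∈ Z, z ∈ outerNbr G C) (hZ : Z.Nontrivial) (hY : Y ⊆ C) (hYne : Y.Nonempty)
    (hsep : ∃ x, Separates G C Z Y x) :
    ∃ x ∈ C, Separates G C Z Y x ∧ ∃ z₁ ∈ Z, ∃ z₂ ∈ Z, z₁ ≠ z₂ ∧
      ∃ S₁ ⊆ insert z₁ C, ∃ S₂ ⊆ insert z₂ C, S₁ ∩ S₂ ⊆ {x} ∧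
        Linked G S₁ z₁ x ∧ Linked G S₂ z₂ x := by
  classical
  have hlink : ∀ z ∈ Z, ∀ c ∈ C, Linked G (insert z C) z c := by
    intro z hz c hc
    obtain ⟨-, d, hd, hdz⟩ := hZC z hz
    exact Linked.trans (.of_adj hdz.symm (Or.inl rfl) (Or.inr hd))
      ((hC d hd c hc).mono (Set.subset_insert _ _))
  have hmemC : ∀ x, Separates G C Z Y x → x ∈ C := by
    intro x hx
    by_contra hxC
    obtain ⟨z, hz, hzx⟩ := hZ.exists_ne x
    obtain ⟨y, hy⟩ := hYne
    refine hx z hz y hy ((hlink z hz y (hY hy)).mono ?_)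
    rintro w (rfl | hw)
    · exact ⟨Or.inr hz, hzx⟩
    · exact ⟨Or.inl hw, fun e => hxC (e ▸ hw)⟩
  -- `R x` is the part of `C` reachable from `Z` without `x`. The separator with smallest `R x` is
  -- the one closest to `Z`.
  let R : V → Set V := fun x => {y | y ∈ C ∧ ∃ z ∈ Z, Linked G ((C ∪ Z) \ {x}) z y}
  obtain ⟨x, hx, hmin⟩ := (Set.toFinite {x | Separates G C Z Y x}).exists_minimalFor
    (fun x => (R x).ncard) _ hsep
  have hxC := hmemC x hx
  have hxZ : x ∉ Z := fun h => (hZC x h).1 hxC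
  have hxR : x ∉ R x := fun h => by
    obtain ⟨-, z, -, hl⟩ := h
    exact hl.right_mem.2 rfl
  refine ⟨x, hxC, hx, ?_⟩
  by_cases hmen : ∀ v, ∃ z ∈ Z, ∃ y ∈ {y | y ∈ R x ∪ Z ∧ G.Adj y x},
      Linked G ((R x ∪ Z) \ {v}) z y
  · obtain ⟨z₁, hz₁, y₁, hy₁, z₂, hz₂, y₂, hy₂, S₁, hS₁, S₂, hS₂, hd, h1, h2, e1, -, e2, -⟩ :=
      menger_two hmen hZ.nonempty
    have hsub : ∀ (S : Set V) (z : V), S ⊆ R x ∪ Z → S ∩ Z ⊆ {z} → insert x S ⊆ insert z C := by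
      rintro S z hS hSz w (rfl | hw)
      · exact Or.inr hxC
      · rcases hS hw with hw' | hw'
        · exact Or.inr hw'.1
        · exact Or.inl (hSz ⟨hw, hw'⟩)
    refine ⟨z₁, hz₁, z₂, hz₂, fun e => ?_, insert x S₁, hsub S₁ z₁ hS₁ e1, insert x S₂,
      hsub S₂ z₂ hS₂ e2, ?_, ?_, ?_⟩
    · exact Set.disjoint_left.1 hd h1.left_mem (e ▸ h2.left_mem)
    · rintro w ⟨(rfl | hw), (hw' | hw')⟩
      · rfl
      · rfl
      · exact hw'
      · exact absurd hw' (Set.disjoint_left.1 hd hw)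
    · exact (h1.mono (Set.subset_insert _ _)).trans
        (.of_adj hy₁.2 (Or.inr h1.right_mem) (Or.inl rfl))
    · exact (h2.mono (Set.subset_insert _ _)).trans
        (.of_adj hy₂.2 (Or.inr h2.right_mem) (Or.inl rfl))
  exfalso
  push Not at hmen
  -- Without a fan, Menger gives a vertex `v` separating `Z` from `x`. Links from `Z` avoiding `v`
  -- then avoid `x` too, so `v` separates `Z` from `Y`, and `R v` is smaller since it lacks `v ∈ R
  -- x`.
  obtain ⟨v, hv⟩ := hmen
  have hvx : ∀ z ∈ Z, ¬Linked G (insert x ((C ∪ Z) \ {v})) z x := by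
    intro z hz hl
    obtain ⟨y, hyx, q, hq⟩ := exists_linked_adj hl fun e => hxZ (e ▸ hz)
    have hqS : ∀ w ∈ q.support, w ∈ (R x ∪ Z) \ {v} := by
      intro w hw
      refine ⟨?_, (hq w hw).1.2⟩
      rcases (hq w hw).1.1 with hwC | hwZ
      · exact Or.inl ⟨hwC, z, hz, q.takeUntil w hw, fun w' hw' =>
          have := hq w' (q.support_takeUntil_subset_support hw hw')
          ⟨this.1.1, this.2⟩⟩
      · exact Or.inr hwZ
    exact hv z hz y ⟨(hqS y q.end_mem_support).1, hyx⟩ ⟨q, hqS⟩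
  have hvC : v ∈ C ∧ v ≠ x := by
    by_contra hcon
    obtain ⟨z, hz, hzv⟩ := hZ.exists_ne v
    refine hvx z hz ((hlink z hz x hxC).mono ?_)
    rintro w (rfl | hw)
    · exact Or.inr ⟨Or.inr hz, hzv⟩
    · by_cases hwx : w = x
      · exact Or.inl hwx
      · refine Or.inr ⟨Or.inl hw, fun e => ?_⟩
        obtain rfl : w = v := e
        exact hcon ⟨hw, hwx⟩
  have havoid : ∀ z ∈ Z, ∀ y, Linked G ((C ∪ Z) \ {v}) z y → Linked G ((C ∪ Z) \ {x}) z y := by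
    rintro z hz y ⟨p, hp⟩
    refine ⟨p, fun w hw => ⟨(hp w hw).1, ?_⟩⟩
    rintro rfl
    exact hvx z hz ⟨p.takeUntil w hw, fun w' hw' =>
      Or.inr (hp w' (p.support_takeUntil_subset_support hw hw'))⟩
  have hvsep : Separates G C Z Y v := fun z hz y hy hl => hx z hz y hy (havoid z hz y hl)
  have hlt : (R v).ncard < (R x).ncard := by
    refine Set.ncard_lt_ncard ⟨?_, fun hsub => ?_⟩
    · rintro y ⟨hyC, z, hz, hl⟩
      exact ⟨hyC, z, hz, havoid z hz y hl⟩
    · have hvR : v ∈ R x := by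
        obtain ⟨z, hz⟩ := hZ.nonempty
        obtain ⟨p, hp, hpS⟩ := (hlink z hz x hxC).exists_isPath
        have hvp : v ∈ p.support := by
          by_contra hvp
          refine hvx z hz ⟨p, fun w hw => Or.inr ⟨?_, fun e => hvp (e ▸ hw)⟩⟩
          rcases hpS w hw with rfl | h
          · exact Or.inr hz
          · exact Or.inl h
        refine ⟨hvC.1, z, hz, p.takeUntil v hvp, fun w hw => ⟨?_, ?_⟩⟩
        · rcases hpS w (p.support_takeUntil_subset_support hvp hw) with rfl | h
          · exact Or.inr hz
          · exact Or.inl h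
        · rintro rfl
          exact Walk.endpoint_notMem_support_takeUntil hp hvp hvC.2.symm hw
      obtain ⟨-, z, -, hl⟩ := hsub hvR
      exact hl.right_mem.2 rfl
  exact absurd (hmin hvsep hlt.le) (not_le.2 hlt)

/-- The outer neighbours of `C` on `A` at distance at least `m` from its end. -/
def farNbr (G : SimpleGraph V) {s a : V} (A : G.Walk s a) (C : Set V) (m : ℕ) : Set V :=
  {z | z ∈ outerNbr G C ∧ ∃ (P : G.Walk s z) (Q : G.Walk z a), A = P.append Q ∧ m ≤ Q.length}

/-- Two vertices on `A` split it into three parts. -/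
theorem exists_append_of_farNbr {s a z₁ z₂ : V} {A : G.Walk s a} {C : Set V} {m : ℕ}
    (h₁ : z₁ ∈ farNbr G A C m) (h₂ : z₂ ∈ farNbr G A C m) :
    (∃ (A₁ : G.Walk s z₁) (A₂ : G.Walk z₁ z₂) (A₃ : G.Walk z₂ a),
      A = A₁.append (A₂.append A₃) ∧ m ≤ A₃.length) ∨
    ∃ (A₁ : G.Walk s z₂) (A₂ : G.Walk z₂ z₁) (A₃ : G.Walk z₁ a),
      A = A₁.append (A₂.append A₃) ∧ m ≤ A₃.length := by
  have key : ∀ {z w : V} (P : G.Walk s z) (Q : G.Walk z a) (P' : G.Walk s w) (Q' : G.Walk w a),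
      A = P.append Q → A = P'.append Q' → P.length ≤ P'.length →
      ∃ (A₁ : G.Walk s z) (A₂ : G.Walk z w), A = A₁.append (A₂.append Q') := by
    intro z w P Q P' Q' hP hP' hle
    have hz : z ∈ P'.support := by
      have h1 : (P.append Q).getVert P.length = z := by simp [Walk.getVert_append]
      rw [← hP, hP', Walk.getVert_append] at h1
      split_ifs at h1 with hlt
      · exact h1 ▸ P'.getVert_mem_support _
      · have : P.length - P'.length = 0 := by omega
        rw [this, Walk.getVert_zero] at h1
        exact h1 ▸ P'.end_mem_support
    obtain ⟨E, F, rfl⟩ := P'.mem_support_iff_exists_append.1 hz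
    exact ⟨E, F, by rw [hP', Walk.append_assoc]⟩
  obtain ⟨-, P₁, Q₁, e₁, l₁⟩ := h₁
  obtain ⟨-, P₂, Q₂, e₂, l₂⟩ := h₂
  rcases le_total P₁.length P₂.length with hle | hle
  · obtain ⟨A₁, A₂, h⟩ := key P₁ Q₁ P₂ Q₂ e₁ e₂ hle
    exact Or.inl ⟨A₁, A₂, Q₂, h, l₂⟩
  · obtain ⟨A₁, A₂, h⟩ := key P₂ Q₂ P₁ Q₁ e₂ e₁ hle
    exact Or.inr ⟨A₁, A₂, Q₁, h, l₁⟩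

theorem nontrivial_farNbr [Finite V] {s a : V} {A : G.Walk s a} {C : Set V} {m : ℕ}
    (h : m + 2 ≤ (outerNbr G C ∩ {z | z ∈ A.support}).ncard) : (farNbr G A C m).Nontrivial := by
  classical
  rw [← Set.one_lt_ncard_iff_nontrivial]
  -- Only the last `m` vertices of `A` are at distance less than `m` from its end.
  have hsub : outerNbr G C ∩ {z | z ∈ A.support} ⊆
      farNbr G A C m ∪ (fun j => A.getVert (A.length - j)) '' (Finset.range m : Set ℕ) := by
    rintro z ⟨hzC, hz⟩
    obtain ⟨P, Q, hPQ⟩ := A.mem_support_iff_exists_append.1 hz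
    by_cases hm : m ≤ Q.length
    · exact Or.inl ⟨hzC, P, Q, hPQ, hm⟩
    · refine Or.inr ⟨Q.length, by simpa using hm, ?_⟩
      subst hPQ
      simp [Walk.getVert_append]
  have h1 := Set.ncard_le_ncard hsub
  have h2 := Set.ncard_union_le (farNbr G A C m)
    ((fun j => A.getVert (A.length - j)) '' (Finset.range m : Set ℕ))
  have h3 := Set.ncard_image_le (f := fun j => A.getVert (A.length - j))
    (Finset.range m).finite_toSet
  rw [Set.ncard_coe_finset, Finset.card_range] at h3
  omega

theorem exists_mem_between {C D : Set V} {a b : V} (hDC : D ⊆ C)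
    (hD : ∀ x ∈ D, ∀ y ∈ D, Linked G D x y) (ha : a ∈ outerNbr G D) (hb : b ∈ outerNbr G D)
    (hab : a ≠ b) : ∃ q ∈ D, q ∈ between G a b C := by
  obtain ⟨haD, c, hc, hca⟩ := ha
  obtain ⟨hbD, d, hd, hdb⟩ := hb
  obtain ⟨p, hp, hpD⟩ := (hD c hc d hd).exists_isPath
  refine ⟨c, hc, hDC hc, .cons hca.symm (p.concat hdb), ?_, ?_, by simp⟩
  · rw [Walk.cons_isPath_iff, Walk.concat_isPath_iff]
    refine ⟨⟨hp, fun h => hbD (hpD b h)⟩, fun h => ?_⟩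
    rw [Walk.support_concat, List.mem_append, List.mem_singleton] at h
    exact h.elim (fun h => haD (hpD a h)) hab
  · intro z hz
    rw [Walk.support_cons, Walk.support_concat, List.mem_cons,
      List.mem_append, List.mem_singleton] at hz
    rcases hz with rfl | hz | rfl
    · simp
    · exact Or.inr (Or.inr (hDC (hpD z hz)))
    · simp

/-- A vertex that separates the far neighbours on `A` from `between G a b C` can be inserted into
the path `A`, which yields a frame for the components attached to both ends of the frame. -/
theorem Frame.framed_of_fan {C D : Set V} {s t a b x z₁ z₂ : V} {A : G.Walk s a} {B : G.Walk t b}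
    {m : ℕ} (h : Frame G A B C) (hC : ∀ x ∈ C, ∀ y ∈ C, Linked G C x y) (hxC : x ∈ C)
    (hx : Separates G C (farNbr G A C m) (between G a b C) x)
    {A₁ : G.Walk s z₁} {A₂ : G.Walk z₁ z₂} {A₃ : G.Walk z₂ a} (hA : A = A₁.append (A₂.append A₃))
    (hm : m ≤ A₃.length) (hz₁ : z₁ ∈ farNbr G A C m) (hz₂ : z₂ ∈ farNbr G A C m) (hz : z₁ ≠ z₂)
    {S₁ S₂ : Set V} (hS₁ : S₁ ⊆ insert z₁ C) (hS₂ : S₂ ⊆ insert z₂ C) (hS : S₁ ∩ S₂ ⊆ {x})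
    (hl₁ : Linked G S₁ z₁ x) (hl₂ : Linked G S₂ z₂ x) (hD : IsComp G (C \ {x}) D)
    (haD : a ∈ outerNbr G D) (hbD : b ∈ outerNbr G D) :
    Framed G s t D ∧ ∀ z ∈ farNbr G A C m, z ∉ outerNbr G D := by
  classical
  have hDC : D ⊆ C := fun w hw => (hD.subset hw).1
  have hDx : D ⊆ (C ∪ farNbr G A C m) \ {x} := fun w hw =>
    ⟨Or.inl (hDC hw), (hD.subset hw).2⟩
  have hab : a ≠ b := fun e => h.disjoint a A.end_mem_support (e ▸ B.end_mem_support)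
  have hfar : ∀ z ∈ farNbr G A C m, z ≠ x := fun z hz e => hz.1.1 (e ▸ hxC)
  -- Attached to both `a` and `b`, `D` meets `between G a b C`, so `x` separates all of `D` from the
  -- far neighbours.
  obtain ⟨q, hqD, hq⟩ := exists_mem_between hDC hD.linked haD hbD hab
  have hno : ∀ z ∈ farNbr G A C m, ∀ w ∈ D, ¬Linked G ((C ∪ farNbr G A C m) \ {x}) z w :=
    fun z hz w hw hl => hx z hz q hq (hl.trans ((hD.linked w hw q hqD).mono hDx))
  have hmiss : ∀ z ∈ farNbr G A C m, z ∉ outerNbr G D := by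
    rintro z hz ⟨-, d, hd, hdz⟩
    exact hno z hz d hd (.of_adj hdz.symm ⟨Or.inr hz, hfar z hz⟩ (hDx hd))
  refine ⟨?_, hmiss⟩
  obtain ⟨p₁, hp₁, hpS₁⟩ := hl₁.exists_isPath
  obtain ⟨p₂, hp₂, hpS₂⟩ := hl₂.exists_isPath
  -- A fan path meeting `D` would link a far neighbour to `D` before reaching `x`.
  have hpD : ∀ {z : V} {S : Set V} (p : G.Walk z x), z ∈ farNbr G A C m → S ⊆ insert z C →
      p.IsPath → (∀ w ∈ p.support, w ∈ S) → ∀ w ∈ p.support, w ∉ D := by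
    intro z S p hz hS hp hpS w hw hwD
    refine hno z hz w hwD ⟨p.takeUntil w hw, fun w' hw' => ⟨?_, ?_⟩⟩
    · rcases hS (hpS w' (p.support_takeUntil_subset_support hw hw')) with rfl | hw'
      · exact Or.inr hz
      · exact Or.inl hw'
    · rintro rfl
      exact Walk.endpoint_notMem_support_takeUntil hp hw (fun e => (hD.subset hwD).2 e.symm) hw'
  have hpD₁ := hpD p₁ hz₁ hS₁ hp₁ hpS₁
  have hpD₂ := hpD p₂ hz₂ hS₂ hp₂ hpS₂
  have hpath : (A₁.append (A₂.append A₃)).IsPath := hA ▸ h.isPath_left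
  have hA23 := hpath.of_append_right
  have hz₁A₃ : z₁ ∉ A₃.support := fun hm => hz (eq_of_mem_append hA23 A₂.start_mem_support hm)
  have h13 : ∀ z ∈ A₁.support, z ∉ A₃.support := fun z h1 h3 =>
    hz₁A₃ (eq_of_mem_append hpath h1 (by simp [h3]) ▸ h3)
  have hmem : ∀ z, z ∈ A.support ↔ z ∈ A₁.support ∨ z ∈ A₂.support ∨ z ∈ A₃.support := by
    intro z; rw [hA]; simp
  have hz₁A : z₁ ∈ A.support := (hmem _).2 (by simp)
  have hz₂A : z₂ ∈ A.support := (hmem _).2 (by simp)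
  have hp₁A : ∀ w ∈ p₁.support, w = z₁ ∨ w ∈ C := fun w hw => hS₁ (hpS₁ w hw)
  have hp₂A : ∀ w ∈ p₂.support, w = z₂ ∨ w ∈ C := fun w hw => hS₂ (hpS₂ w hw)
  have hA₁C : ∀ w ∈ A₁.support, w ∉ C := fun w hw => h.left_notMem w ((hmem w).2 (Or.inl hw))
  have hA₃C : ∀ w ∈ A₃.support, w ∉ C := fun w hw =>
    h.left_notMem w ((hmem w).2 (Or.inr (Or.inr hw)))
  let A' := A₁.append (p₁.append (p₂.reverse.append A₃))
  have hmem' : ∀ z, z ∈ A'.support ↔ z ∈ A₁.support ∨ z ∈ p₁.support ∨ z ∈ p₂.support ∨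
      z ∈ A₃.support := by
    intro z; simp [A']
  have hA' : A'.IsPath := by
    refine isPath_append hpath.of_append_left (isPath_append hp₁ (isPath_append hp₂.reverse
      hA23.of_append_right ?_) ?_) ?_
    · intro w hw hw'
      exact (hp₂A w (by simpa using hw)).resolve_right (hA₃C w hw')
    · intro w hw hw'
      rw [Walk.mem_support_append_iff, Walk.support_reverse, List.mem_reverse] at hw'
      rcases hw' with hw' | hw'
      · exact hS ⟨hpS₁ w hw, hpS₂ w hw'⟩
      · rcases hp₁A w hw with rfl | hwC
        · exact absurd hw' hz₁A₃
        · exact absurd hwC (hA₃C w hw')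
    · intro w hw hw'
      rw [Walk.mem_support_append_iff, Walk.mem_support_append_iff, Walk.support_reverse,
        List.mem_reverse] at hw'
      rcases hw' with hw' | hw' | hw'
      · exact (hp₁A w hw').resolve_right (hA₁C w hw)
      · rcases hp₂A w hw' with rfl | hwC
        · exact absurd A₃.start_mem_support (h13 w hw)
        · exact absurd hwC (hA₁C w hw)
      · exact absurd hw' (h13 w hw)
  have hxA' : x ∈ A'.support := (hmem' x).2 (Or.inr (Or.inl p₁.end_mem_support))
  refine Framed.of_isPath hA' h.isPath_right ?_ ?_ ?_ ?_
    ⟨x, hxA', hD.mem_outerNbr hC hxC⟩ ⟨b, B.end_mem_support, hbD⟩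
  · intro w hw hwB
    rcases (hmem' w).1 hw with hw | hw | hw | hw
    · exact h.disjoint w ((hmem w).2 (Or.inl hw)) hwB
    · rcases hp₁A w hw with rfl | hwC
      · exact h.disjoint w hz₁A hwB
      · exact h.right_notMem w hwB hwC
    · rcases hp₂A w hw with rfl | hwC
      · exact h.disjoint w hz₂A hwB
      · exact h.right_notMem w hwB hwC
    · exact h.disjoint w ((hmem w).2 (Or.inr (Or.inr hw))) hwB
  · intro w hw hwD
    rcases (hmem' w).1 hw with hw | hw | hw | hw
    · exact hA₁C w hw (hDC hwD)
    · exact hpD₁ w hw hwD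
    · exact hpD₂ w hw hwD
    · exact hA₃C w hw (hDC hwD)
  · exact fun w hw hwD => h.right_notMem w hw (hDC hwD)
  · intro v hv
    rcases hD.outerNbr_diff_subset hv with rfl | hvC
    · exact Or.inl hxA'
    · rcases h.cover v hvC with hvA | hvB
      · left
        rcases (hmem v).1 hvA with hvA | hvA | hvA
        · exact (hmem' v).2 (Or.inl hvA)
        -- The bypassed segment `A₂` precedes `z₂`, so outer neighbours of `C` on it are far and
        -- need not be covered.
        · obtain ⟨E, F, rfl⟩ := A₂.mem_support_iff_exists_append.1 hvA
          refine absurd hv (hmiss v ⟨hvC, A₁.append E, F.append A₃, ?_, ?_⟩)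
          · rw [hA]; simp only [Walk.append_assoc]
          · rw [Walk.length_append]; omega
        · exact (hmem' v).2 (Or.inr (Or.inr (Or.inr hvA)))
      · exact Or.inr hvB

/-! ### The deletion step and the treewidth bound -/

/-- A component of `C - σ` that misses an outer neighbour of `C` has at most as many outer
neighbours as `C`. -/
theorem IsComp.ncard_outerNbr_le [Finite V] {C D : Set V} {σ w : V} (hD : IsComp G (C \ {σ}) D)
    (hw : w ∈ outerNbr G C) (hwσ : w ≠ σ) (hwD : w ∉ outerNbr G D) :
    (outerNbr G D).ncard ≤ (outerNbr G C).ncard := by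
  have hsub : outerNbr G D ⊆ insert σ (outerNbr G C \ {w}) := by
    intro v hv
    rcases hD.outerNbr_diff_subset hv with rfl | h
    · exact Or.inl rfl
    · exact Or.inr ⟨h, fun e => hwD (e ▸ hv)⟩
  have h1 := Set.ncard_le_ncard hsub
  have h2 := Set.ncard_insert_le σ (outerNbr G C \ {w})
  have h3 := Set.ncard_sdiff_singleton_add_one hw
  omega

/-- A component that misses an end of the frame inherits a frame. -/
theorem Frame.framed_of_notMem [Finite V] {C D : Set V} {s t a b σ : V} {A : G.Walk s a}
    {B : G.Walk t b} (h : Frame G A B C)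
    (hrel : ∀ v, ∃ p : G.Walk s t, p.IsPath ∧ v ∈ p.support)
    (hC : ∀ x ∈ C, ∀ y ∈ C, Linked G C x y) (hσ : σ ∈ C) (hD : IsComp G (C \ {σ}) D)
    (hab : a ∉ outerNbr G D ∨ b ∉ outerNbr G D) :
    Framed G s t D ∧ (outerNbr G D).ncard ≤ (outerNbr G C).ncard := by
  rcases hab with ha | hb
  · exact ⟨h.framed_of_linked hrel hC hσ hD (hD.linked_insert hC hσ h.left_end ha),
      hD.ncard_outerNbr_le h.left_end (fun e => h.left_end.1 (e ▸ hσ)) ha⟩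
  · have hrel' : ∀ v, ∃ p : G.Walk t s, p.IsPath ∧ v ∈ p.support := fun v => by
      obtain ⟨p, hp, hv⟩ := hrel v
      exact ⟨p.reverse, hp.reverse, by simpa using hv⟩
    exact ⟨(h.symm.framed_of_linked hrel' hC hσ hD (hD.linked_insert hC hσ h.right_end hb)).symm,
      hD.ncard_outerNbr_le h.right_end (fun e => h.right_end.1 (e ▸ hσ)) hb⟩

/-- If `A` contains many outer neighbours of `C`, and no vertex of `C` separates the ends of the
frame, then some vertex of `C` breaks it up into framed components. -/
theorem Frame.exists_step_of_many [Finite V] {C : Set V} {s t a b : V} {A : G.Walk s a}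
    {B : G.Walk t b} {k : ℕ} (hk0 : 0 < k) (h : Frame G A B C)
    (hk : ∀ p : G.Walk s t, p.IsPath → p.length < G.dist s t + k)
    (hrel : ∀ v, ∃ p : G.Walk s t, p.IsPath ∧ v ∈ p.support)
    (hC : ∀ x ∈ C, ∀ y ∈ C, Linked G C x y)
    (hstar : ∀ σ ∈ C, ∃ D, IsComp G (C \ {σ}) D ∧ a ∈ outerNbr G D ∧ b ∈ outerNbr G D)
    (hmany : 3 * k + 2 ≤ (outerNbr G C ∩ {z | z ∈ A.support}).ncard) :
    ∃ σ ∈ C, ∀ D, IsComp G (C \ {σ}) D →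
      Framed G s t D ∧ (outerNbr G D).ncard ≤ (outerNbr G C).ncard := by
  have hab : a ≠ b := fun e => h.disjoint a A.end_mem_support (e ▸ B.end_mem_support)
  have hZ := nontrivial_farNbr hmany
  have hstar' : ∀ σ ∈ C, Linked G (insert a (insert b C) \ {σ}) a b := by
    intro σ hσ
    obtain ⟨D, hD, ⟨haD, c, hc, hca⟩, ⟨hbD, d, hd, hdb⟩⟩ := hstar σ hσ
    have hsub : D ⊆ insert a (insert b C) \ {σ} := fun w hw =>
      ⟨Or.inr (Or.inr (hD.subset hw).1), (hD.subset hw).2⟩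
    have ha : a ∈ insert a (insert b C) \ {σ} := ⟨by simp, fun e => h.left_end.1 (e ▸ hσ)⟩
    have hb : b ∈ insert a (insert b C) \ {σ} := ⟨by simp, fun e => h.right_end.1 (e ▸ hσ)⟩
    exact (Linked.of_adj hca.symm ha (hsub hc)).trans
      (((hD.linked c hc d hd).mono hsub).trans (.of_adj hdb (hsub hd) hb))
  obtain ⟨q₀, -, hq₀⟩ := exists_mem_between subset_rfl hC h.left_end h.right_end hab
  have hsep : ∃ x, Separates G C (farNbr G A C (3 * k)) (between G a b C) x := by
    by_contra hno
    unfold Separates at hno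
    push Not at hno
    obtain ⟨z₁, hz₁, q₁, hq₁, z₂, hz₂, q₂, hq₂, S₁, hS₁, S₂, hS₂, hd, l₁, l₂, e₁, f₁, e₂, f₂⟩ :=
      menger_two hno hZ.nonempty
    have hS₁' : S₁ ⊆ insert z₁ C := fun w hw =>
      (hS₁ hw).elim Or.inr fun hw' => Or.inl (e₁ ⟨hw, hw'⟩)
    have hS₂' : S₂ ⊆ insert z₂ C := fun w hw =>
      (hS₂ hw).elim Or.inr fun hw' => Or.inl (e₂ ⟨hw, hw'⟩)
    rcases exists_append_of_farNbr hz₁ hz₂ with ⟨A₁, A₂, A₃, rfl, hm⟩ | ⟨A₁, A₂, A₃, rfl, hm⟩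
    · exact not_disjoint_links hk0 hk h hm hstar' hq₁ hq₂ hS₁' hS₂' hd l₁ l₂ f₁ f₂
    · exact not_disjoint_links hk0 hk h hm hstar' hq₂ hq₁ hS₂' hS₁' hd.symm l₂ l₁ f₂ f₁
  obtain ⟨x, hxC, hx, z₁, hz₁, z₂, hz₂, hz, S₁, hS₁, S₂, hS₂, hS, l₁, l₂⟩ :=
    exists_separates_fan hC (fun z hz => hz.1) hZ (fun q hq => hq.1) ⟨q₀, hq₀⟩ hsep
  refine ⟨x, hxC, fun D hD => ?_⟩
  by_cases hD' : a ∉ outerNbr G D ∨ b ∉ outerNbr G D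
  · exact h.framed_of_notMem hrel hC hxC hD hD'
  push Not at hD'
  have key : Framed G s t D ∧ ∀ z ∈ farNbr G A C (3 * k), z ∉ outerNbr G D := by
    rcases exists_append_of_farNbr hz₁ hz₂ with ⟨A₁, A₂, A₃, hA, hm⟩ | ⟨A₁, A₂, A₃, hA, hm⟩
    · exact h.framed_of_fan hC hxC hx hA hm hz₁ hz₂ hz hS₁ hS₂ hS l₁ l₂ hD hD'.1 hD'.2
    · exact h.framed_of_fan hC hxC hx hA hm hz₂ hz₁ hz.symm hS₂ hS₁ (by rwa [Set.inter_comm])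
        l₂ l₁ hD hD'.1 hD'.2
  exact ⟨key.1, hD.ncard_outerNbr_le hz₁.1 (fun e => hz₁.1.1 (e ▸ hxC)) (key.2 z₁ hz₁)⟩

/-- A connected framed set with at most `6 * k + 3` outer neighbours is broken up by some vertex
into sets of the same kind, if there are no long detours. -/
theorem exists_step [Finite V] {C : Set V} {s t : V} {k : ℕ} (hk0 : 0 < k)
    (hk : ∀ p : G.Walk s t, p.IsPath → p.length < G.dist s t + k)
    (hrel : ∀ v, ∃ p : G.Walk s t, p.IsPath ∧ v ∈ p.support)
    (hC : ∀ x ∈ C, ∀ y ∈ C, Linked G C x y) (hF : Framed G s t C)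
    (hcard : (outerNbr G C).ncard ≤ 6 * k + 3) :
    ∃ σ ∈ C, ∀ D, IsComp G (C \ {σ}) D →
      Framed G s t D ∧ (outerNbr G D).ncard ≤ 6 * k + 3 := by
  obtain ⟨a, b, A, B, h⟩ := hF
  by_cases hlt : (outerNbr G C).ncard < 6 * k + 3
  · obtain ⟨haC, σ, hσ, hσa⟩ := h.left_end
    refine ⟨σ, hσ, fun D hD => ⟨h.framed_of_linked hrel hC hσ hD ?_, ?_⟩⟩
    · exact .of_adj hσa.symm (Or.inl rfl) (Or.inr ⟨hσ, fun hσD => (hD.subset hσD).2 rfl⟩)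
    · have h1 := Set.ncard_le_ncard hD.outerNbr_diff_subset
      have h2 := Set.ncard_insert_le σ (outerNbr G C)
      omega
  by_cases hsplit : ∃ σ ∈ C, ∀ D, IsComp G (C \ {σ}) D →
      a ∉ outerNbr G D ∨ b ∉ outerNbr G D
  · obtain ⟨σ, hσ, hsplit⟩ := hsplit
    refine ⟨σ, hσ, fun D hD => ?_⟩
    have := h.framed_of_notMem hrel hC hσ hD (hsplit D hD)
    exact ⟨this.1, this.2.trans hcard⟩
  push Not at hsplit
  have hcov : outerNbr G C ⊆ (outerNbr G C ∩ {z | z ∈ A.support}) ∪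
      (outerNbr G C ∩ {z | z ∈ B.support}) := fun v hv =>
    (h.cover v hv).imp (fun h => ⟨hv, h⟩) fun h => ⟨hv, h⟩
  have h1 := Set.ncard_le_ncard hcov
  have h2 := Set.ncard_union_le (outerNbr G C ∩ {z | z ∈ A.support})
    (outerNbr G C ∩ {z | z ∈ B.support})
  -- Since `6k + 3 > 2(3k + 1)`, one of `A` and `B` contains at least `3k + 2` outer neighbours.
  by_cases hmany : 3 * k + 2 ≤ (outerNbr G C ∩ {z | z ∈ A.support}).ncard
  · obtain ⟨σ, hσ, hstep⟩ := h.exists_step_of_many hk0 hk hrel hC hsplit hmany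
    exact ⟨σ, hσ, fun D hD => ⟨(hstep D hD).1, (hstep D hD).2.trans hcard⟩⟩
  · have hk' : ∀ p : G.Walk t s, p.IsPath → p.length < G.dist t s + k := fun p hp => by
      have := hk p.reverse hp.reverse
      rwa [Walk.length_reverse, dist_comm] at this
    have hrel' : ∀ v, ∃ p : G.Walk t s, p.IsPath ∧ v ∈ p.support := fun v => by
      obtain ⟨p, hp, hv⟩ := hrel v
      exact ⟨p.reverse, hp.reverse, by simpa using hv⟩
    obtain ⟨σ, hσ, hstep⟩ := h.symm.exists_step_of_many hk0 hk' hrel' hC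
      (fun σ hσ => (hsplit σ hσ).imp fun D hD => ⟨hD.1, hD.2.2, hD.2.1⟩) (by omega)
    exact ⟨σ, hσ, fun D hD => ⟨(hstep D hD).1.symm, (hstep D hD).2.trans hcard⟩⟩

/-- If every vertex lies on an `s`-`t` path and there are no long detours, then the treewidth is
small. -/
theorem treewidth_le_of_no_detour [Finite V] {s t : V} {k : ℕ} (hk0 : 0 < k)
    (hk : ∀ p : G.Walk s t, p.IsPath → p.length < G.dist s t + k)
    (hrel : ∀ v, ∃ p : G.Walk s t, p.IsPath ∧ v ∈ p.support) : treewidth G ≤ 6 * k + 3 := by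
  have hdecomp := hasDecomp_of_step (G := G) (N := 6 * k + 3)
    (P := fun C => (∀ x ∈ C, ∀ y ∈ C, Linked G C x y) ∧ Framed G s t C ∧
      (outerNbr G C).ncard ≤ 6 * k + 3) (fun C hC => hC.2.2)
    (fun C ⟨hC, hF, hcard⟩ => by
      obtain ⟨σ, hσ, hstep⟩ := exists_step hk0 hk hrel hC hF hcard
      exact ⟨σ, hσ, fun D hD => ⟨hD.linked, hstep D hD⟩⟩)
    -- Every component of the complement of `{s, t}` is attached to both `s` and `t`, and the
    -- trivial paths at `s` and `t` frame it.
    {s, t}ᶜ {s, t} disjoint_compl_left (fun D hD => ?_) (fun v hv => not_not.1 hv.1) ?_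
  · rw [Set.compl_union_self] at hdecomp
    have := hdecomp.treewidth_le
    push_cast at this
    linarith
  · have hs : s ∉ D := fun h => hD.subset h (by simp)
    have ht : t ∉ D := fun h => hD.subset h (by simp)
    have hsub : outerNbr G D ⊆ {s, t} := fun v hv => not_not.1 (hD.outerNbr_inter hv)
    obtain ⟨d, hd⟩ := hD.nonempty
    obtain ⟨p, hp, hdp⟩ := hrel d
    obtain ⟨x, hx, y, hy, hxy⟩ := exists_ne_mem_outerNbr hp hdp hd hs ht
    have hst : s ∈ outerNbr G D ∧ t ∈ outerNbr G D ∧ s ≠ t := by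
      rcases hsub hx with rfl | rfl <;> rcases hsub hy with rfl | rfl
      · exact absurd rfl hxy
      · exact ⟨hx, hy, hxy⟩
      · exact ⟨hy, hx, hxy.symm⟩
      · exact absurd rfl hxy
    refine ⟨hD.linked, ⟨s, t, .nil, .nil, ⟨.nil, .nil, ?_, ?_, ?_, ?_, hst.1, hst.2.1⟩⟩, ?_⟩
    · simpa using hst.2.2
    · simpa using hs
    · simpa using ht
    · intro v hv
      simpa using hsub hv
    · have h1 := Set.ncard_le_ncard hsub
      have h2 := Set.ncard_insert_le s {t}
      rw [Set.ncard_singleton] at h2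
      omega
  · have := Set.ncard_insert_le s {t}
    rw [Set.ncard_singleton] at this
    omega

end LongestDetour

theorem mainTheorem1 : LongestDetour.DetourEnforcing.{u} (fun k => 32 * k + 2) := by
  intro k V _ G s t htw
  open LongestDetour in
  by_contra hno
  push Not at hno
  by_cases hne : (relevantSet G s t).Nonempty
  swap
  · rw [Set.not_nonempty_iff_eq_empty] at hne
    have : IsEmpty (relevantSet G s t) := by rw [hne]; infer_instance
    have hD : HasDecomp (relevantPart G s t) Set.univ ∅ 0 := by
      rw [Set.univ_eq_empty_iff.2 this]
      exact HasDecomp.single (by simp)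
    have := hD.treewidth_le
    push_cast at this htw
    linarith
  obtain ⟨v, p, hp, -⟩ := hne
  have hk0 : 0 < k := by
    have h1 := hno p hp
    have h2 := SimpleGraph.dist_le p
    omega
  have hs : s ∈ relevantSet G s t := ⟨p, hp, p.start_mem_support⟩
  have ht : t ∈ relevantSet G s t := ⟨p, hp, p.end_mem_support⟩
  have hrel : ∀ v, ∃ q : (G.induce (relevantSet G s t)).Walk ⟨s, hs⟩ ⟨t, ht⟩,
      q.IsPath ∧ v ∈ q.support := by
    rintro ⟨v, q, hq, hv⟩
    have hqs : ∀ x ∈ q.support, x ∈ relevantSet G s t := fun x hx => ⟨q, hq, hx⟩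
    refine ⟨q.induce _ hqs, ?_, ?_⟩
    · refine SimpleGraph.Walk.IsPath.of_map (f := (SimpleGraph.Embedding.induce _).toHom) ?_
      rwa [SimpleGraph.Walk.map_induce]
    · rw [SimpleGraph.Walk.support_induce]
      simpa using hv
  -- Distances in an induced subgraph are at least those in `G`, so the absence of detours is
  -- inherited.
  have hk : ∀ q : (G.induce (relevantSet G s t)).Walk ⟨s, hs⟩ ⟨t, ht⟩, q.IsPath →
      q.length < (G.induce (relevantSet G s t)).dist ⟨s, hs⟩ ⟨t, ht⟩ + k := by
    intro q hq
    let f : G.induce (relevantSet G s t) ↪g G := SimpleGraph.Embedding.induce _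
    have h1 : q.length < G.dist s t + k := (SimpleGraph.Walk.length_map f.toHom q).symm.trans_lt
      (hno (q.map f.toHom) (hq.map f.injective))
    obtain ⟨r, hr⟩ := SimpleGraph.Reachable.exists_walk_length_eq_dist ⟨q⟩
    have h2 : G.dist s t ≤ r.length :=
      (SimpleGraph.dist_le (r.map f.toHom)).trans_eq (SimpleGraph.Walk.length_map f.toHom r)
    omega
  have : treewidth (relevantPart G s t) ≤ 6 * k + 3 := treewidth_le_of_no_detour hk0 hk hrel
  have hk1 : (1 : ℤ) ≤ k := by exact_mod_cast hk0
  push_cast at htw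
  linarith
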